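/- Let $\Omega\subset\mathbb R^3$ be a bounded simply connected domain with connected $C^\infty$ boundary, let $N$ be its outer unit normal, $\beta=(0,0,1)$ and $\mathbf F(x)=\tfrac12(-x_2,x_1,0)$. Suppose that $\Gamma=\{x\in\partial\Omega : \beta\cdot N(x)=0\}$ is a smooth regular one-dimensional submanifold of $\partial\Omega$. For $x\in\Omega$ put $t(x)=\operatorname{dist}(x,\partial\Omega)$, and, for $x$ close to $\partial\Omega$, let $d_\Gamma(x)=\operatorname{dist}_{\partial\Omega}(y(x),\Gamma)$, where $y(x)$ is the boundary point closest to $x$ and $\operatorname{dist}_{\partial\Omega}$ is the distance on $\partial\Omega$ associated with the induced Riemannian metric. Let $\Gamma_j$ be a connected component of $\Gamma$, let $s_0\in\Gamma_j$, and for $\epsilon>0$ let $$\Omega(\epsilon,s_0)=\{x\in\Omega : \operatorname{dist}(x,\Gamma_j)<\epsilon \text{ and } \operatorname{dist}(x,s_0)>\epsilon\}.$$ Then there is $\epsilon_0>0$ such that for every $\epsilon\in(0,\epsilon_0)$ there exist a function $\phi\in C^\infty(\overline\Omega)$ (the restriction of a $C^\infty$ function on $\mathbb R^3$) and a constant $C$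 (which may depend on $\epsilon$ and $\phi$) such that $$|\mathbf F(x)+\nabla\phi(x)|\le C\big(t(x)+d_\Gamma(x)^2\big)\qquad\text{for all } x\in\Omega(\epsilon,s_0).$$ -/

import Mathlib

open Set MeasureTheory
open scoped ContDiff ENNReal

namespace GaugeNearTangency

/-- Euclidean three-space. -/
abbrev E3 : Type := EuclideanSpace ℝ (Fin 3)

/-- The constant magnetic field along the third axis. -/
noncomputable def beta : E3 := !₂[0, 0, 1]

/-- The vector potential `F(x₁, x₂, x₃) = (-x₂, x₁, 0) / 2`. -/
noncomputable def F (x : E3) : E3 := !₂[-(x 1) / 2, x 0 / 2, 0]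

/-- `ρ` is a smooth defining function of `Ω` on the open set `U`: its gradient does not vanish on
`U`, and `Ω` is given in `U` by `ρ < 0` (so that `∂Ω` is given in `U` by `ρ = 0`). -/
structure IsDefiningFunction (Ω U : Set E3) (ρ : E3 → ℝ) : Prop where
  isOpen : IsOpen U
  contDiffOn : ContDiffOn ℝ ∞ ρ U
  gradient_ne_zero : ∀ x ∈ U, gradient ρ x ≠ 0
  mem_iff : ∀ x ∈ U, x ∈ Ω ↔ ρ x < 0

/-- The boundary of `Ω` is smooth, with `Ω` locally on one side of it. -/
def HasSmoothBoundary (Ω : Set E3) : Prop :=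
  ∀ p ∈ frontier Ω, ∃ (U : Set E3) (ρ : E3 → ℝ), p ∈ U ∧ IsDefiningFunction Ω U ρ

/-- `ν` is the outer unit normal `N(x)` of `Ω` at `x`, that is, the normalized gradient at `x`
of a defining function of `Ω` near `x`. -/
def IsOuterUnitNormal (Ω : Set E3) (x ν : E3) : Prop :=
  ∃ (U : Set E3) (ρ : E3 → ℝ), x ∈ U ∧ IsDefiningFunction Ω U ρ ∧
    ν = ‖gradient ρ x‖⁻¹ • gradient ρ x

/-- The set `Γ` of the boundary points at which `β` is tangent to `∂Ω`, i.e. `β · N(x) = 0`. -/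
def Gam (Ω : Set E3) : Set E3 :=
  {x | x ∈ frontier Ω ∧ ∃ ν, IsOuterUnitNormal Ω x ν ∧ inner ℝ beta ν = 0}

/-- `S` is a smooth regular (embedded) one-dimensional submanifold: near each of its points there
is a smooth chart of `ℝ³` in which `S` is the part of the chart domain where the last two
coordinates vanish. A subset of a smooth surface is a regular submanifold of that surface if and
only if it is a regular submanifold of `ℝ³`. -/
def IsRegularCurve (S : Set E3) : Prop :=
  ∀ p ∈ S, ∃ Φ : OpenPartialHomeomorph E3 E3, p ∈ Φ.source ∧
    ContDiffOn ℝ ∞ Φ Φ.source ∧ ContDiffOn ℝ ∞ Φ.symm Φ.target ∧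
    ∀ x ∈ Φ.source, x ∈ S ↔ Φ x 1 = 0 ∧ Φ x 2 = 0

/-- The distance on a surface `S` for the metric induced from `ℝ³`: the infimum of the lengths of
the `C¹` curves in `S` from `x` to `y` (infinite if there is none). -/
noncomputable def surfaceEDist (S : Set E3) (x y : E3) : ℝ≥0∞ :=
  ⨅ γ ∈ {γ : ℝ → E3 | ContDiffOn ℝ 1 γ (Icc 0 1) ∧ MapsTo γ (Icc 0 1) S ∧ γ 0 = x ∧ γ 1 = y},
    ∫⁻ τ in Icc (0 : ℝ) 1, ‖derivWithin γ (Icc 0 1) τ‖ₑ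

/-- The distance `t(x)` to the boundary. -/
noncomputable def t (Ω : Set E3) (x : E3) : ℝ := Metric.infDist x (frontier Ω)

/-- `y` is a boundary point closest to `x`. -/
def IsClosestBoundaryPoint (Ω : Set E3) (x y : E3) : Prop :=
  y ∈ frontier Ω ∧ dist x y = t Ω x

/-- `d_Γ(x)`, the distance on `∂Ω` from `y(x)` to `Γ`, where `y(x)` is the boundary point closest
to `x`. This point is unique for `x` near the boundary; elsewhere, to have a function on the whole
space, the infimum over all closest points is taken. For `x ∈ ∂Ω` the closest point is `x`. -/
noncomputable def dGam (Ω : Set E3) (x : E3) : ℝ :=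
  (⨅ y ∈ {y | IsClosestBoundaryPoint Ω x y}, ⨅ z ∈ Gam Ω,
    surfaceEDist (frontier Ω) y z).toReal

/-- The part of `Ω` at distance less than `ε` from the curve `Γj` and more than `ε` from `s₀`. -/
def cutTube (Ω Γj : Set E3) (ε : ℝ) (s₀ : E3) : Set E3 :=
  {x | x ∈ Ω ∧ Metric.infDist x Γj < ε ∧ ε < dist x s₀}

end GaugeNearTangency

/-!
The field `F` is linear and antisymmetric: `F d` is half of the cross product of `β` and `d`. On
`∂Ω`, the tangential part of `F` is a one-form whose exterior derivative is `β · N` times the area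
form, and this vanishes on `Γ`. This is why `F + ∇φ` can be made to vanish along `Γ` together with
its derivatives in the directions tangent to `∂Ω`, which is what the estimate asks for.

*Local potentials.* Let `π` be a smooth retraction onto `Γ` near a point of `Γ`, put
`d = x - π x`, and let `n` be the unit normal at `π x`. The Taylor polynomial
`φ = H - ⟪F (π x), d⟫ + ⟪n, d⟫ ⟪F n, d⟫`, where `H` is a primitive of `-F` along the curve, does
the job (`taylorPotential`): since `β` is tangent, `n` is horizontal and
`F d = ⟪n, d⟫ F n - ⟪F n, d⟫ n` (`F_eq_of_horizontal`), so that all terms of `F + ∇φ` contain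
`⟪n, d⟫` or two factors `d` (`inner_F_add_gradient_taylorPotential`). At a boundary point `⟪n, d⟫`
is of order `‖d‖²`, as `x` and `π x` both lie on the surface. This gives `O(t + δ²)` near the point,
where `δ` is the Euclidean distance to `Γ` (`exists_local_potential`).

*Gluing.* Local potentials can be glued by cut-off functions as soon as they have the same
restriction `h` to `Γ`, because then they agree to second order along `Γ` (`IsPotentialAt.glue`).
Such an `h` is a primitive of `-F` along the component `Γj`, and it exists once `s₀` is removed,
because `Γj` is a simple closed curve: a unit speed curve starting at `s₀` returns to `s₀` by
compactness, always in its original direction, and it is injective before its first return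
(`IsRegularCurve.exists_closed_parametrization`, `IsRegularCurve.exists_primitive`).

*Conclusion.* Points of the closure of the cut tube that are not on `Γ` have `δ > 0`, so by
compactness `F + ∇φ = O(t + δ²)` on the cut tube. Finally `δ ≤ d_Γ + t` (`infDist_Gam_le`), because
curves are at least as long as their chords; here `∂Ω` being connected is needed to know that `d_Γ`
is not the junk value of an infinite distance.
-/

open Filter Topology

namespace GaugeNearTangency

/-! ### Smooth boundaries and the tangency set -/

lemma IsDefiningFunction.contDiffAt {Ω U : Set E3} {ρ : E3 → ℝ} (h : IsDefiningFunction Ω U ρ)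
    {x : E3} (hx : x ∈ U) : ContDiffAt ℝ ∞ ρ x :=
  h.contDiffOn.contDiffAt (h.isOpen.mem_nhds hx)

lemma IsDefiningFunction.hasGradientAt {Ω U : Set E3} {ρ : E3 → ℝ}
    (h : IsDefiningFunction Ω U ρ) {x : E3} (hx : x ∈ U) :
    HasGradientAt ρ (gradient ρ x) x :=
  ((h.contDiffAt hx).differentiableAt (by simp)).hasGradientAt

lemma HasGradientAt.hasDerivAt_line {f : E3 → ℝ} {g x : E3} (h : HasGradientAt f g x) (v : E3) :
    HasDerivAt (fun s : ℝ => f (x + s • v)) (inner ℝ g v) 0 := by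
  have h1 : HasDerivAt (fun s : ℝ => x + s • v) v 0 := by
    simpa using ((hasDerivAt_id (0 : ℝ)).smul_const v).const_add x
  have h2 : HasFDerivAt f (InnerProductSpace.toDual ℝ E3 g) (x + (0 : ℝ) • v) := by
    simpa using h.hasFDerivAt
  exact (h2.comp_hasDerivAt (0 : ℝ) h1).congr_deriv (by simp)

lemma eventually_lt_of_hasDerivAt_neg {f : ℝ → ℝ} {m : ℝ} (h : HasDerivAt f m 0) (hm : m < 0) :
    ∀ᶠ s in 𝓝[>] (0 : ℝ), f s < f 0 := by
  have h1 := (hasDerivAt_iff_tendsto_slope.1 h).mono_left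
    (nhdsWithin_mono (0 : ℝ) (fun s (hs : s ∈ Ioi (0 : ℝ)) => ne_of_gt hs))
  filter_upwards [h1.eventually (gt_mem_nhds hm), self_mem_nhdsWithin] with s hs hs0
  rw [slope_def_field] at hs
  have hs0' : (0 : ℝ) < s := hs0
  rw [div_lt_iff₀ (by linarith)] at hs
  linarith

lemma HasGradientAt.eventually_lt {f : E3 → ℝ} {g x v : E3} (h : HasGradientAt f g x)
    (hv : inner ℝ g v < 0) : ∀ᶠ s in 𝓝[>] (0 : ℝ), f (x + s • v) < f x := by
  simpa using eventually_lt_of_hasDerivAt_neg (HasGradientAt.hasDerivAt_line h v) hv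

lemma HasGradientAt.eventually_gt {f : E3 → ℝ} {g x v : E3} (h : HasGradientAt f g x)
    (hv : 0 < inner ℝ g v) : ∀ᶠ s in 𝓝[>] (0 : ℝ), f x < f (x + s • v) := by
  have := eventually_lt_of_hasDerivAt_neg (HasGradientAt.hasDerivAt_line h v).neg (by linarith)
  simpa using this

lemma tendsto_line (x v : E3) : Tendsto (fun s : ℝ => x + s • v) (𝓝[>] 0) (𝓝 x) := by
  have : Continuous (fun s : ℝ => x + s • v) := by fun_prop
  simpa using (this.tendsto 0).mono_left nhdsWithin_le_nhds

/-- In the domain of a defining function, the boundary is its zero set. -/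
lemma IsDefiningFunction.mem_frontier_iff {Ω U : Set E3} {ρ : E3 → ℝ} (hΩ : IsOpen Ω)
    (h : IsDefiningFunction Ω U ρ) {x : E3} (hx : x ∈ U) : x ∈ frontier Ω ↔ ρ x = 0 := by
  rw [hΩ.frontier_eq, Set.mem_sdiff, h.mem_iff x hx, not_lt]
  have hc : ContinuousAt ρ x := (h.contDiffAt hx).continuousAt
  constructor
  · rintro ⟨h1, h2⟩
    refine le_antisymm ?_ h2
    by_contra! h3
    have h4 : ∀ᶠ y in 𝓝 x, 0 < ρ y ∧ y ∈ U :=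
      (hc.eventually (lt_mem_nhds h3)).and (h.isOpen.mem_nhds hx)
    obtain ⟨y, ⟨hy, hyU⟩, hyΩ⟩ := mem_closure_iff_nhds.1 h1 _ h4
    exact absurd ((h.mem_iff y hyU).1 hyΩ) (not_lt.2 hy.le)
  · intro h0
    refine ⟨?_, h0.ge⟩
    have hg := HasGradientAt.eventually_lt (h.hasGradientAt hx) (v := -gradient ρ x) (by
      rw [inner_neg_right, real_inner_self_eq_norm_sq]
      have := norm_pos_iff.2 (h.gradient_ne_zero x hx)
      have := pow_pos this 2
      linarith)
    have ht := tendsto_line x (-gradient ρ x)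
    refine mem_closure_of_tendsto ht ?_
    filter_upwards [hg, ht.eventually (h.isOpen.mem_nhds hx)] with s hs hsU
    exact (h.mem_iff _ hsU).2 (h0 ▸ hs)

/-- Two defining functions have the same tangent directions at a boundary point: otherwise some
direction would lead into `Ω` for one of them and out of `Ω` for the other. -/
lemma IsDefiningFunction.inner_gradient_eq_zero {Ω U V : Set E3} {ρ σ : E3 → ℝ} (hΩ : IsOpen Ω)
    (h : IsDefiningFunction Ω U ρ) (h' : IsDefiningFunction Ω V σ) {x v : E3} (hx : x ∈ U)
    (hxV : x ∈ V) (hxf : x ∈ frontier Ω) (hv : inner ℝ v (gradient ρ x) = 0) :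
    inner ℝ v (gradient σ x) = 0 := by
  have hρ0 := (h.mem_frontier_iff hΩ hx).1 hxf
  have hσ0 := (h'.mem_frontier_iff hΩ hxV).1 hxf
  -- it suffices to exclude directions `w` with `⟪∇ρ, w⟫ < 0 < ⟪∇σ, w⟫`
  have key : ∀ w, inner ℝ (gradient ρ x) w < 0 → 0 < inner ℝ (gradient σ x) w → False := by
    intro w h1 h2
    have ht := tendsto_line x w
    obtain ⟨s, h3, h4, h5, h6⟩ := ((HasGradientAt.eventually_lt (h.hasGradientAt hx) h1).and
      ((HasGradientAt.eventually_gt (h'.hasGradientAt hxV) h2).and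
      ((ht.eventually (h.isOpen.mem_nhds hx)).and
      (ht.eventually (h'.isOpen.mem_nhds hxV))))).exists
    have := (h'.mem_iff _ h6).1 ((h.mem_iff _ h5).2 (hρ0 ▸ h3))
    linarith
  have hn : 0 < ‖gradient ρ x‖ ^ 2 := pow_pos (norm_pos_iff.2 (h.gradient_ne_zero x hx)) 2
  rw [real_inner_comm] at hv ⊢
  by_contra hne
  -- perturb the direction `± v` slightly towards `-∇ρ`
  set a := inner ℝ (gradient σ x) v with ha
  set b := inner ℝ (gradient σ x) (gradient ρ x) with hb
  have hb1 : 0 < |b| + 1 := by positivity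
  refine key (a • v - (a ^ 2 / (2 * (|b| + 1))) • gradient ρ x) ?_ ?_
  · rw [inner_sub_right, inner_smul_right, inner_smul_right, hv, real_inner_self_eq_norm_sq]
    have : 0 < a ^ 2 / (2 * (|b| + 1)) := by positivity
    nlinarith [mul_pos this hn]
  · rw [inner_sub_right, inner_smul_right, inner_smul_right, ← ha, ← hb]
    have h1 : a ^ 2 / (2 * (|b| + 1)) * b ≤ a ^ 2 / 2 := by
      rw [div_mul_eq_mul_div, div_le_div_iff₀ (by positivity) (by norm_num)]
      nlinarith [le_abs_self b, sq_nonneg a]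
    have : 0 < a ^ 2 := by positivity
    nlinarith

/-- Tangency of `β` may be tested on any defining function. -/
lemma IsDefiningFunction.mem_Gam_iff {Ω U : Set E3} {ρ : E3 → ℝ} (hΩ : IsOpen Ω)
    (h : IsDefiningFunction Ω U ρ) {x : E3} (hx : x ∈ U) :
    x ∈ Gam Ω ↔ ρ x = 0 ∧ inner ℝ beta (gradient ρ x) = 0 := by
  constructor
  · rintro ⟨hxf, ν, ⟨V, σ, hxV, hσ, rfl⟩, hν⟩
    refine ⟨(h.mem_frontier_iff hΩ hx).1 hxf, hσ.inner_gradient_eq_zero hΩ h hxV hx hxf ?_⟩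
    rw [inner_smul_right] at hν
    exact (mul_eq_zero.1 hν).resolve_left
      (inv_ne_zero (norm_ne_zero_iff.2 (hσ.gradient_ne_zero x hxV)))
  · rintro ⟨h0, hb⟩
    refine ⟨(h.mem_frontier_iff hΩ hx).2 h0, _, ⟨U, ρ, hx, h, rfl⟩, ?_⟩
    rw [inner_smul_right, hb, mul_zero]

lemma IsDefiningFunction.contDiffOn_gradient {Ω U : Set E3} {ρ : E3 → ℝ}
    (h : IsDefiningFunction Ω U ρ) : ContDiffOn ℝ ∞ (gradient ρ) U := by
  have h1 : ContDiffOn ℝ ∞ (fderiv ℝ ρ) U :=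
    h.contDiffOn.fderiv_of_isOpen h.isOpen (by simp)
  exact (InnerProductSpace.toDual ℝ E3).symm.toContinuousLinearEquiv.contDiff.comp_contDiffOn h1

lemma isClosed_Gam {Ω : Set E3} (hΩ : IsOpen Ω) (hs : HasSmoothBoundary Ω) :
    IsClosed (Gam Ω) := by
  rw [← closure_subset_iff_isClosed]
  intro x hx
  have hxf : x ∈ frontier Ω :=
    closure_minimal (fun y hy => hy.1) isClosed_frontier hx
  obtain ⟨U, ρ, hxU, h⟩ := hs x hxf
  rw [h.mem_Gam_iff hΩ hxU]
  refine ⟨(h.mem_frontier_iff hΩ hxU).1 hxf, ?_⟩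
  have hc : ContinuousAt (fun y => inner ℝ beta (gradient ρ y)) x :=
    continuousAt_const.inner
      (h.contDiffOn_gradient.continuousOn.continuousAt (h.isOpen.mem_nhds hxU))
  by_contra hne
  obtain ⟨y, ⟨hy1, hyU⟩, hyΓ⟩ := mem_closure_iff_nhds.1 hx _
    ((hc.eventually_ne hne).and (h.isOpen.mem_nhds hxU))
  exact hy1 ((h.mem_Gam_iff hΩ hyU).1 hyΓ).2

lemma isCompact_frontier {Ω : Set E3} (hb : Bornology.IsBounded Ω) : IsCompact (frontier Ω) :=
  Metric.isCompact_of_isClosed_isBounded isClosed_frontier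
    (hb.closure.subset frontier_subset_closure)

lemma isCompact_Gam {Ω : Set E3} (hΩ : IsOpen Ω) (hb : Bornology.IsBounded Ω)
    (hs : HasSmoothBoundary Ω) : IsCompact (Gam Ω) :=
  (isCompact_frontier hb).of_isClosed_subset (isClosed_Gam hΩ hs) (fun _ hx => hx.1)

/-! ### The induced distance on the boundary -/

/-- `x` and `y` are the ends of a `C¹` curve in `S` that is constant before time `0` and after
time `1`, so that such curves can be concatenated without losing smoothness. -/
def JoinedInSurface (S : Set E3) (x y : E3) : Prop :=
  ∃ γ : ℝ → E3, ContDiff ℝ 1 γ ∧ (∀ s, γ s ∈ S) ∧ (∀ s ≤ 0, γ s = x) ∧ ∀ s, 1 ≤ s → γ s = y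

lemma JoinedInSurface.symm {S : Set E3} {x y : E3} (h : JoinedInSurface S x y) :
    JoinedInSurface S y x := by
  obtain ⟨γ, h1, h2, h3, h4⟩ := h
  refine ⟨fun s => γ (1 - s), h1.comp (by fun_prop), fun s => h2 _, fun s hs => h4 _ (by linarith),
    fun s hs => h3 _ (by linarith)⟩

lemma JoinedInSurface.trans {S : Set E3} {x y z : E3} (h : JoinedInSurface S x y)
    (h' : JoinedInSurface S y z) : JoinedInSurface S x z := by
  obtain ⟨γ, h1, h2, h3, h4⟩ := h
  obtain ⟨δ, k1, k2, k3, k4⟩ := h'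
  -- one of the two curves is at rest at `y` at any time, so that the sum is the concatenation
  refine ⟨fun s => γ (2 * s) + δ (2 * s - 1) - y,
    ((h1.comp (by fun_prop)).add (k1.comp (by fun_prop))).sub contDiff_const, fun s => ?_,
    fun s hs => ?_, fun s hs => ?_⟩
  · rcases le_total s (1 / 2) with hs | hs
    · simpa [k3 (2 * s - 1) (by linarith)] using h2 (2 * s)
    · simpa [h4 (2 * s) (by linarith)] using k2 (2 * s - 1)
  · simp [k3 (2 * s - 1) (by linarith), h3 (2 * s) (by linarith)]
  · simp [h4 (2 * s) (by linarith), k4 (2 * s - 1) (by linarith)]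

lemma JoinedInSurface.surfaceEDist_ne_top {S : Set E3} {x y : E3} (h : JoinedInSurface S x y) :
    surfaceEDist S x y ≠ ⊤ := by
  obtain ⟨γ, h1, h2, h3, h4⟩ := h
  have hmem : γ ∈ {γ : ℝ → E3 | ContDiffOn ℝ 1 γ (Icc 0 1) ∧ MapsTo γ (Icc 0 1) S ∧ γ 0 = x ∧
      γ 1 = y} := ⟨h1.contDiffOn, fun s _ => h2 s, h3 0 le_rfl, h4 1 le_rfl⟩
  refine ne_top_of_le_ne_top ?_ (iInf₂_le γ hmem)
  have hc : ContinuousOn (fun τ => ‖derivWithin γ (Icc 0 1) τ‖) (Icc (0 : ℝ) 1) :=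
    (h1.contDiffOn.continuousOn_derivWithin (uniqueDiffOn_Icc_zero_one) le_rfl).norm
  obtain ⟨C, hC⟩ := isCompact_Icc.bddAbove_image hc
  have hle : ∫⁻ τ in Icc (0 : ℝ) 1, ‖derivWithin γ (Icc 0 1) τ‖ₑ
      ≤ ∫⁻ _ in Icc (0 : ℝ) 1, ENNReal.ofReal C := by
    refine setLIntegral_mono' measurableSet_Icc fun τ hτ => ?_
    rw [← ofReal_norm]
    exact ENNReal.ofReal_le_ofReal (hC ⟨τ, hτ, rfl⟩)
  refine ne_top_of_le_ne_top ?_ hle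
  simp

/-- Near a boundary point, a defining function can be completed to a chart in which the boundary
is a plane; segments in this plane give curves in the boundary. -/
lemma eventually_joinedInSurface {Ω : Set E3} (hΩ : IsOpen Ω) (hs : HasSmoothBoundary Ω) {p : E3}
    (hp : p ∈ frontier Ω) : ∀ᶠ x in 𝓝[frontier Ω] p, JoinedInSurface (frontier Ω) p x := by
  obtain ⟨U, ρ, hpU, h⟩ := hs p hp
  set g := gradient ρ p with hg
  have hg0 : ‖g‖ ^ 2 ≠ 0 := pow_ne_zero 2 (norm_ne_zero_iff.2 (h.gradient_ne_zero p hpU))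
  set Ψ : E3 → E3 := fun x => x + ((‖g‖ ^ 2)⁻¹ * (ρ x - inner ℝ g x)) • g with hΨ
  have hΨg : ∀ x, inner ℝ g (Ψ x) = ρ x := by
    intro x
    rw [hΨ]
    simp only
    rw [inner_add_right, inner_smul_right, real_inner_self_eq_norm_sq]
    rw [mul_right_comm, inv_mul_cancel₀ hg0]
    ring
  have hρ : ContDiffAt ℝ 1 ρ p := (h.contDiffAt hpU).of_le (by simp)
  have hΨc : ContDiffAt ℝ 1 Ψ p := by
    refine contDiffAt_id.add (ContDiffAt.smul (contDiffAt_const.mul (hρ.sub ?_)) contDiffAt_const)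
    exact contDiffAt_const.inner ℝ contDiffAt_id
  have hΨd : HasFDerivAt Ψ ((ContinuousLinearEquiv.refl ℝ E3 : E3 ≃L[ℝ] E3) : E3 →L[ℝ] E3) p := by
    have h1 := (h.hasGradientAt hpU).hasFDerivAt
    have h2 : HasFDerivAt (fun x => inner ℝ g x) (InnerProductSpace.toDual ℝ E3 g) p :=
      (InnerProductSpace.toDual ℝ E3 g).hasFDerivAt
    have h3 := (hasFDerivAt_id p).add (((h1.sub h2).const_mul ((‖g‖ ^ 2)⁻¹)).smul_const g)
    refine h3.congr_fderiv ?_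
    ext v : 1
    simp [hg]
  set e := hΨc.toOpenPartialHomeomorph Ψ hΨd one_ne_zero with he
  have hes : p ∈ e.source := hΨc.mem_toOpenPartialHomeomorph_source hΨd one_ne_zero
  have heΨ : ∀ x, e x = Ψ x := fun x => rfl
  have het : Ψ p ∈ e.target := e.map_source hes
  have hsymm : e.symm (Ψ p) = p := e.left_inv hes
  have hinv : ContDiffAt ℝ 1 e.symm (Ψ p) :=
    e.contDiffAt_symm het (f₀' := ContinuousLinearEquiv.refl ℝ E3)
      (by rw [hsymm]; exact hΨd) (by rw [hsymm]; exact hΨc)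
  have hev : ∀ᶠ y in 𝓝 (Ψ p), ContDiffAt ℝ 1 e.symm y ∧ y ∈ e.target ∧ e.symm y ∈ U :=
    (hinv.eventually (by simp)).and ((e.open_target.eventually_mem het).and
      (hinv.continuousAt.eventually (by rw [hsymm]; exact h.isOpen.mem_nhds hpU)))
  obtain ⟨r, hr, hball⟩ := Metric.eventually_nhds_iff_ball.1 hev
  have hρp := (h.mem_frontier_iff hΩ hpU).1 hp
  have hnear : ∀ᶠ x in 𝓝 p, x ∈ e.source ∧ x ∈ U ∧ Ψ x ∈ Metric.ball (Ψ p) r :=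
    (e.open_source.eventually_mem hes).and ((h.isOpen.eventually_mem hpU).and
      (hΨc.continuousAt.eventually (Metric.ball_mem_nhds _ hr)))
  filter_upwards [nhdsWithin_le_nhds hnear, self_mem_nhdsWithin] with x ⟨hxe, hxU, hxb⟩ hxf
  have hρx := (h.mem_frontier_iff hΩ hxU).1 hxf
  have hin : ∀ s, AffineMap.lineMap (Ψ p) (Ψ x) (Real.smoothTransition s) ∈
      Metric.ball (Ψ p) r := fun s =>
    (convex_ball (Ψ p) r).segment_subset (Metric.mem_ball_self hr) hxb
      (lineMap_mem_segment ℝ _ _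
        ⟨Real.smoothTransition.nonneg s, Real.smoothTransition.le_one s⟩)
  refine ⟨fun s => e.symm (AffineMap.lineMap (Ψ p) (Ψ x) (Real.smoothTransition s)), ?_, ?_, ?_, ?_⟩
  · rw [contDiff_iff_contDiffAt]
    intro s
    refine (hball _ (hin s)).1.comp s ?_
    have : ContDiff ℝ 1 (fun s => AffineMap.lineMap (Ψ p) (Ψ x) (Real.smoothTransition s)) := by
      simp only [AffineMap.lineMap_apply]
      have := Real.smoothTransition.contDiff (n := 1)
      exact (ContDiff.smul this contDiff_const).add contDiff_const
    exact this.contDiffAt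
  · intro s
    obtain ⟨-, h2, h3⟩ := hball _ (hin s)
    rw [h.mem_frontier_iff hΩ h3, ← hΨg, ← heΨ, e.right_inv h2, AffineMap.lineMap_apply]
    simp only [vsub_eq_sub, vadd_eq_add]
    rw [inner_add_right, inner_smul_right, inner_sub_right, hΨg, hΨg, hρp, hρx]
    simp
  · intro s hs
    simp [Real.smoothTransition.zero_of_nonpos hs, hsymm]
  · intro s hs
    simp only
    rw [Real.smoothTransition.one_of_one_le hs, AffineMap.lineMap_apply_one, ← heΨ, e.left_inv hxe]

lemma surfaceEDist_frontier_ne_top {Ω : Set E3} (hΩ : IsOpen Ω) (hs : HasSmoothBoundary Ω)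
    (hc : IsPreconnected (frontier Ω)) {x y : E3} (hx : x ∈ frontier Ω) (hy : y ∈ frontier Ω) :
    surfaceEDist (frontier Ω) x y ≠ ⊤ :=
  (hc.induction₂ (JoinedInSurface (frontier Ω))
    (fun _ hz => eventually_joinedInSurface hΩ hs hz)
    (fun _ _ _ _ _ _ h1 h2 => h1.trans h2) (fun _ _ _ _ h1 => h1.symm)
    hx hy).surfaceEDist_ne_top

/-- A curve is at least as long as its chord. -/
lemma edist_le_surfaceEDist (S : Set E3) (x y : E3) : edist x y ≤ surfaceEDist S x y := by
  refine le_iInf₂ fun γ hγ => ?_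
  obtain ⟨h1, -, rfl, rfl⟩ := hγ
  rw [edist_comm, edist_eq_enorm_sub]
  exact enorm_sub_le_lintegral_derivWithin_Icc_of_contDiffOn_Icc h1 zero_le_one

lemma exists_isClosestBoundaryPoint {Ω : Set E3} (hb : Bornology.IsBounded Ω)
    (hne : (frontier Ω).Nonempty) (x : E3) : ∃ y, IsClosestBoundaryPoint Ω x y := by
  obtain ⟨y, hy, h⟩ := (isCompact_frontier hb).exists_infDist_eq_dist hne x
  exact ⟨y, hy, h.symm⟩

/-- The Euclidean distance to `Γ` is controlled by `t` and `d_Γ`. -/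
lemma infDist_Gam_le {Ω : Set E3} (hΩ : IsOpen Ω) (hb : Bornology.IsBounded Ω)
    (hs : HasSmoothBoundary Ω) (hc : IsPreconnected (frontier Ω)) (hne : (Gam Ω).Nonempty)
    (x : E3) : Metric.infDist x (Gam Ω) ≤ dGam Ω x + t Ω x := by
  obtain ⟨z₀, hz₀⟩ := hne
  obtain ⟨y₀, hy₀⟩ := exists_isClosestBoundaryPoint hb ⟨z₀, hz₀.1⟩ x
  have hfin : (⨅ y ∈ {y | IsClosestBoundaryPoint Ω x y}, ⨅ z ∈ Gam Ω,
      surfaceEDist (frontier Ω) y z) ≠ ⊤ :=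
    ne_top_of_le_ne_top (surfaceEDist_frontier_ne_top hΩ hs hc hy₀.1 hz₀.1)
      (le_trans (iInf₂_le y₀ hy₀) (iInf₂_le z₀ hz₀))
  have hle : ENNReal.ofReal (Metric.infDist x (Gam Ω) - t Ω x) ≤
      ⨅ y ∈ {y | IsClosestBoundaryPoint Ω x y}, ⨅ z ∈ Gam Ω,
        surfaceEDist (frontier Ω) y z := by
    refine le_iInf₂ fun y hy => le_iInf₂ fun z hz =>
      le_trans ?_ (edist_le_surfaceEDist (frontier Ω) y z)
    rw [edist_dist]
    refine ENNReal.ofReal_le_ofReal ?_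
    have h1 := Metric.infDist_le_dist_of_mem (x := x) hz
    have h2 := dist_triangle x y z
    have h3 : dist x y = t Ω x := hy.2
    linarith
  have := (ENNReal.ofReal_le_iff_le_toReal hfin).1 hle
  change Metric.infDist x (Gam Ω) - t Ω x ≤ dGam Ω x at this
  linarith

/-! ### The linear field `F` -/

/-- The vector potential `F` as a continuous linear map. -/
noncomputable def FL : E3 →L[ℝ] E3 :=
  LinearMap.toContinuousLinearMap
    { toFun := F
      map_add' := fun x y => by ext i; fin_cases i <;> simp [F] <;> ring
      map_smul' := fun a x => by ext i; fin_cases i <;> simp [F] <;> ring }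

@[simp] lemma FL_apply (x : E3) : FL x = F x := rfl

lemma F_sub (x y : E3) : F (x - y) = F x - F y := FL.map_sub x y

lemma F_smul (a : ℝ) (x : E3) : F (a • x) = a • F x := FL.map_smul a x

lemma contDiff_F : ContDiff ℝ ∞ F := FL.contDiff

lemma norm_F_le (x : E3) : ‖F x‖ ≤ ‖x‖ := by
  rw [EuclideanSpace.norm_eq, EuclideanSpace.norm_eq]
  refine Real.sqrt_le_sqrt ?_
  simp only [Fin.sum_univ_three, Real.norm_eq_abs, sq_abs]
  simp [F]
  nlinarith [sq_nonneg (x 0), sq_nonneg (x 1), sq_nonneg (x 2)]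

/-- `F` is antisymmetric. -/
lemma inner_F_left (x y : E3) : inner ℝ (F x) y = -inner ℝ (F y) x := by
  simp [F, PiLp.inner_apply, Fin.sum_univ_three]
  ring

/-- For a horizontal unit vector `n`, the vectors `F n` and `n` span the horizontal plane, in
which `F` is half of a quarter turn. -/
lemma F_eq_of_horizontal {n : E3} (hn : ‖n‖ = 1) (h2 : n 2 = 0) (d : E3) :
    F d = inner ℝ n d • F n - inner ℝ (F n) d • n := by
  have h1 : n 0 ^ 2 + n 1 ^ 2 = 1 := by
    have := EuclideanSpace.norm_sq_eq n
    rw [hn] at this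
    simp only [Fin.sum_univ_three, Real.norm_eq_abs, sq_abs, h2] at this
    linarith
  ext i
  fin_cases i
  · simp [F, PiLp.inner_apply, Fin.sum_univ_three, h2]
    linear_combination (d 1 / 2) * h1
  · simp [F, PiLp.inner_apply, Fin.sum_univ_three, h2]
    linear_combination (-d 0 / 2) * h1
  · simp [F, h2]

lemma inner_beta (x : E3) : inner ℝ beta x = x 2 := by
  simp [beta, PiLp.inner_apply, Fin.sum_univ_three]

/-! ### Smooth germs, Taylor estimates and charts of the curve -/

lemma exists_contDiff_eventuallyEq {E G : Type*} [NormedAddCommGroup E] [InnerProductSpace ℝ E]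
    [NormedAddCommGroup G] [NormedSpace ℝ G] {f : E → G} {U : Set E}
    (hU : IsOpen U) (hf : ContDiffOn ℝ ∞ f U) {p : E} (hp : p ∈ U) :
    ∃ g : E → G, ContDiff ℝ ∞ g ∧ g =ᶠ[𝓝 p] f := by
  obtain ⟨r, hr, hrU⟩ := Metric.isOpen_iff.1 hU p hp
  let χ : ContDiffBump p := ⟨r / 4, r / 2, by linarith, by linarith⟩
  refine ⟨fun x => χ x • f x, ?_, ?_⟩
  · rw [contDiff_iff_contDiffAt]
    intro x
    by_cases hx : x ∈ U
    · exact χ.contDiff.contDiffAt.smul (hf.contDiffAt (hU.mem_nhds hx))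
    · have hx' : x ∈ (Metric.closedBall p (r / 2))ᶜ := fun h =>
        hx (hrU (Metric.closedBall_subset_ball (by linarith) h))
      refine (contDiffAt_const (c := (0 : G))).congr_of_eventuallyEq ?_
      filter_upwards [Metric.isClosed_closedBall.isOpen_compl.mem_nhds hx'] with y hy
      rw [χ.zero_of_le_dist (not_le.1 fun h => hy (Metric.mem_closedBall.2 h)).le, zero_smul]
  · filter_upwards [χ.eventuallyEq_one] with x hx
    simp [hx]

lemma exists_taylor_bound {f : E3 → ℝ} {p : E3} (hf : ContDiffAt ℝ ∞ f p) :
    ∃ C, 0 ≤ C ∧ ∃ r > 0, ∀ x ∈ Metric.ball p r, ∀ z ∈ Metric.ball p r,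
      |f x - f z - fderiv ℝ f z (x - z)| ≤ C * ‖x - z‖ ^ 2 := by
  have h1 : ContDiffAt ℝ 1 (fderiv ℝ f) p :=
    (hf.fderiv_right (m := ∞) (by simp)).of_le (by simp)
  obtain ⟨K, s, hs, hK⟩ := h1.exists_lipschitzOnWith
  have h2 : ∀ᶠ x in 𝓝 p, DifferentiableAt ℝ f x ∧ x ∈ s :=
    (((hf.of_le (m := 1) (by simp)).eventually (by simp)).mono
      fun x hx => hx.differentiableAt (by simp)).and hs
  obtain ⟨r, hr, hball⟩ := Metric.eventually_nhds_iff_ball.1 h2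
  refine ⟨K, K.2, r, hr, fun x hx z hz => ?_⟩
  have hseg : segment ℝ z x ⊆ Metric.ball p r := (convex_ball p r).segment_subset hz hx
  have := (convex_segment z x).norm_image_sub_le_of_norm_hasFDerivWithin_le' (f := f)
    (f' := fderiv ℝ f) (φ := fderiv ℝ f z) (C := K * ‖x - z‖)
    (fun y hy => (hball y (hseg hy)).1.hasFDerivAt.hasFDerivWithinAt)
    (fun y hy => ?_) (left_mem_segment ℝ z x) (right_mem_segment ℝ z x)
  · rw [Real.norm_eq_abs] at this
    calc _ ≤ _ := this
      _ = _ := by ring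
  · refine (hK.norm_sub_le (hball y (hseg hy)).2 (hball z hz).2).trans ?_
    gcongr
    obtain ⟨a, b, ha, hb, hab, rfl⟩ := hy
    have : a • z + b • x - z = b • (x - z) := by
      rw [smul_sub, eq_sub_of_add_eq hab]; module
    rw [this, norm_smul, Real.norm_of_nonneg hb]
    exact mul_le_of_le_one_left (norm_nonneg _) (by linarith)

/-- A regular curve is parametrized near each of its points by a smooth `c`, with a smooth
coordinate `u` on the ambient space that inverts `c`. In particular, `c ∘ u` is a smooth
retraction onto the curve. -/
lemma IsRegularCurve.exists_chart {S : Set E3} (hS : IsRegularCurve S) {p : E3} (hp : p ∈ S) :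
    ∃ (c : ℝ → E3) (u : E3 → ℝ), ContDiff ℝ ∞ c ∧ ContDiff ℝ ∞ u ∧ u p = 0 ∧
      (∀ᶠ s in 𝓝 (0 : ℝ), c s ∈ S ∧ u (c s) = s) ∧ ∀ᶠ x in 𝓝 p, x ∈ S → c (u x) = x := by
  obtain ⟨Φ, hpΦ, hΦ, hΦ', hS⟩ := hS p hp
  set s₀ := Φ p 0 with hs₀
  set l : ℝ → E3 := fun s => !₂[s + s₀, 0, 0] with hl
  have hlc : ContDiff ℝ ∞ l := by
    rw [contDiff_euclidean]
    intro i
    fin_cases i <;> simp [hl] <;> fun_prop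
  have hline : ∀ x ∈ Φ.source, x ∈ S → l (Φ x 0 - s₀) = Φ x := by
    intro x hx hxS
    obtain ⟨h1, h2⟩ := (hS x hx).1 hxS
    ext i
    fin_cases i <;> simp [hl, h1, h2]
  have hl0 : l 0 = Φ p := by simpa [hs₀] using hline p hpΦ hp
  set V : Set ℝ := l ⁻¹' Φ.target with hV
  have hVo : IsOpen V := Φ.open_target.preimage hlc.continuous
  have h0V : (0 : ℝ) ∈ V := by
    change l 0 ∈ Φ.target
    rw [hl0]; exact Φ.map_source hpΦ
  obtain ⟨c, hc, hceq⟩ := exists_contDiff_eventuallyEq (f := fun s => Φ.symm (l s)) hVo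
    (hΦ'.comp hlc.contDiffOn (fun s hs => hs)) h0V
  obtain ⟨u, hu, hueq⟩ := exists_contDiff_eventuallyEq (G := ℝ) (f := fun x => Φ x 0 - s₀) Φ.open_source
    (((contDiff_euclidean.1 contDiff_id 0).comp_contDiffOn hΦ).sub contDiffOn_const) hpΦ
  have hup : u p = 0 := by simpa [hs₀] using hueq.self_of_nhds
  have hc0 : c 0 = p := by
    simpa [hl0, Φ.left_inv hpΦ] using hceq.self_of_nhds
  refine ⟨c, u, hc, hu, hup, ?_, ?_⟩
  · have h1 : ∀ᶠ s in 𝓝 (0 : ℝ), u (c s) = Φ (c s) 0 - s₀ :=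
      (hc.continuous.tendsto' 0 p hc0).eventually hueq
    filter_upwards [h1, hceq, hVo.mem_nhds h0V] with s hs1 hs2 hs3
    have h3 : Φ (c s) = l s := by rw [hs2, Φ.right_inv hs3]
    refine ⟨?_, ?_⟩
    · rw [hS _ (by rw [hs2]; exact Φ.map_target hs3), h3]
      simp [hl]
    · rw [hs1, h3]
      simp [hl]
  · have h1 : ∀ᶠ x in 𝓝 p, c (u x) = Φ.symm (l (u x)) :=
      (hu.continuous.tendsto' p 0 hup).eventually hceq
    filter_upwards [h1, hueq, Φ.open_source.mem_nhds hpΦ] with x hx1 hx2 hx3 hxS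
    rw [hx1, hx2, hline x hx3 hxS, Φ.left_inv hx3]

/-! ### Local potentials near the curve -/

/-- The quadratic Taylor model of a potential along the curve `c`. Here `c ∘ u` is a retraction
onto the curve, `N` is the normal of the surface along the curve, and `H` is the restriction of the
potential to the curve. -/
noncomputable def taylorPotential (H : ℝ → ℝ) (c N : ℝ → E3) (u : E3 → ℝ) (x : E3) : ℝ :=
  H (u x) - inner ℝ (F (c (u x))) (x - c (u x)) +
    inner ℝ (N (u x)) (x - c (u x)) * inner ℝ (F (N (u x))) (x - c (u x))

lemma contDiff_taylorPotential {H : ℝ → ℝ} {c N : ℝ → E3} {u : E3 → ℝ} (hH : ContDiff ℝ ∞ H)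
    (hc : ContDiff ℝ ∞ c) (hN : ContDiff ℝ ∞ N) (hu : ContDiff ℝ ∞ u) :
    ContDiff ℝ ∞ (taylorPotential H c N u) := by
  have hcu := hc.comp hu
  have hNu := hN.comp hu
  have hd := contDiff_id.sub hcu
  exact ((hH.comp hu).sub ((contDiff_F.comp hcu).inner ℝ hd)).add
    ((hNu.inner ℝ hd).mul ((contDiff_F.comp hNu).inner ℝ hd))

/-- The gauge transformed field of the Taylor model: every term contains the factor `⟪N, d⟫`
or two factors `d = x - c (u x)`. -/
lemma inner_F_add_gradient_taylorPotential {H : ℝ → ℝ} {c N : ℝ → E3} {u : E3 → ℝ}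
    (hH : ContDiff ℝ ∞ H) (hc : ContDiff ℝ ∞ c) (hN : ContDiff ℝ ∞ N) (hu : ContDiff ℝ ∞ u)
    {y : E3} (hH' : deriv H (u y) = -inner ℝ (F (c (u y))) (deriv c (u y)))
    (hN1 : ‖N (u y)‖ = 1) (hN2 : N (u y) 2 = 0)
    (hNc : inner ℝ (N (u y)) (deriv c (u y)) = 0) (w : E3) :
    inner ℝ (F y + gradient (taylorPotential H c N u) y) w =
      inner ℝ (N (u y)) (y - c (u y)) * (2 * inner ℝ (F (N (u y))) w +
        fderiv ℝ u y w * inner ℝ (F (deriv N (u y))) (y - c (u y))) +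
      fderiv ℝ u y w * inner ℝ (deriv N (u y)) (y - c (u y)) *
        inner ℝ (F (N (u y))) (y - c (u y)) := by
  have h0 : y + (0 : ℝ) • w = y := by simp
  have hline : HasDerivAt (fun s : ℝ => y + s • w) w 0 := by
    simpa using ((hasDerivAt_id (0 : ℝ)).smul_const w).const_add y
  have hu1 : HasDerivAt (fun s : ℝ => u (y + s • w)) (fderiv ℝ u y w) 0 := by
    have h1 : HasFDerivAt u (fderiv ℝ u y) (y + (0 : ℝ) • w) := by
      rw [h0]; exact (hu.differentiable (by simp) y).hasFDerivAt
    exact h1.comp_hasDerivAt (0 : ℝ) hline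
  have key : ∀ {f : ℝ → E3}, ContDiff ℝ ∞ f →
      HasDerivAt (fun s : ℝ => f (u (y + s • w))) (fderiv ℝ u y w • deriv f (u y)) 0 := by
    intro f hf
    have h1 : HasDerivAt f (deriv f (u y)) (u (y + (0 : ℝ) • w)) := by
      rw [h0]; exact (hf.differentiable (by simp) _).hasDerivAt
    exact h1.scomp (0 : ℝ) hu1
  have keyF : ∀ {f : ℝ → E3}, ContDiff ℝ ∞ f →
      HasDerivAt (fun s : ℝ => F (f (u (y + s • w)))) (fderiv ℝ u y w • F (deriv f (u y))) 0 := by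
    intro f hf
    rw [← F_smul]
    exact FL.hasFDerivAt.comp_hasDerivAt (0 : ℝ) (key hf)
  have hHd : HasDerivAt (fun s : ℝ => H (u (y + s • w)))
      (deriv H (u y) * fderiv ℝ u y w) 0 := by
    have h1 : HasDerivAt H (deriv H (u y)) (u (y + (0 : ℝ) • w)) := by
      rw [h0]; exact (hH.differentiable (by simp) _).hasDerivAt
    exact h1.comp (0 : ℝ) hu1
  have hd := hline.sub (key hc)
  have hφ := (hHd.sub ((keyF hc).inner ℝ hd)).add
    (((key hN).inner ℝ hd).mul ((keyF hN).inner ℝ hd))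
  have hg : HasGradientAt (taylorPotential H c N u) (gradient (taylorPotential H c N u) y) y :=
    ((contDiff_taylorPotential hH hc hN hu).differentiable (by simp) y).hasGradientAt
  have huniq := (HasGradientAt.hasDerivAt_line hg w).unique hφ
  rw [inner_add_left, huniq]
  simp only [h0, Pi.sub_apply]
  set d := y - c (u y) with hd'
  have hFy : F y = F (c (u y)) + F d := by rw [hd', F_sub]; abel
  have hFd := F_eq_of_horizontal hN1 hN2 d
  have h1 : inner ℝ (F d) w = inner ℝ (N (u y)) d * inner ℝ (F (N (u y))) w -
      inner ℝ (F (N (u y))) d * inner ℝ (N (u y)) w := by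
    rw [hFd, inner_sub_left, real_inner_smul_left, real_inner_smul_left]
  have h2 : inner ℝ (F (deriv c (u y))) d = -(inner ℝ (N (u y)) d *
      inner ℝ (F (N (u y))) (deriv c (u y))) := by
    rw [inner_F_left, hFd, inner_sub_left, real_inner_smul_left, real_inner_smul_left, hNc]
    ring
  simp only [hFy, inner_add_left, inner_sub_right, inner_smul_right, real_inner_smul_left, hH', h1,
    h2, hNc]
  ring

lemma eventually_of_closest {K : Set E3} {p : E3} (hp : p ∈ K) {P : E3 → Prop}
    (hP : ∀ᶠ y in 𝓝 p, P y) : ∀ᶠ x in 𝓝 p, ∀ y, dist x y = Metric.infDist x K → P y := by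
  obtain ⟨r, hr, h⟩ := Metric.eventually_nhds_iff_ball.1 hP
  filter_upwards [Metric.ball_mem_nhds p (half_pos hr)] with x hx y hxy
  refine h y ?_
  have h1 := Metric.infDist_le_dist_of_mem (x := x) hp
  have h2 := dist_triangle_left y p x
  rw [Metric.mem_ball] at hx ⊢
  linarith

/-- A bound on the boundary extends to the ambient space at the cost of a multiple of `t`. -/
lemma eventually_norm_le_of_frontier {Ω : Set E3} (hb : Bornology.IsBounded Ω) {p : E3}
    (hp : p ∈ Gam Ω) {A : E3 → E3} (hA : ContDiffAt ℝ 1 A p) {C : ℝ} (hC : 0 ≤ C)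
    (h : ∀ᶠ y in 𝓝 p, y ∈ frontier Ω → ‖A y‖ ≤ C * Metric.infDist y (Gam Ω) ^ 2) :
    ∃ C', ∀ᶠ x in 𝓝 p, ‖A x‖ ≤ C' * (t Ω x + Metric.infDist x (Gam Ω) ^ 2) := by
  obtain ⟨L, s, hs, hL⟩ := hA.exists_lipschitzOnWith
  have hs' : ∀ᶠ y in 𝓝 p, y ∈ s := hs
  refine ⟨L + 2 * C, ?_⟩
  filter_upwards [eventually_of_closest hp.1 (h.and hs'), hs', Metric.ball_mem_nhds p one_pos]
    with x hx hxs hx1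
  obtain ⟨y, hyf, hy⟩ := exists_isClosestBoundaryPoint hb ⟨p, hp.1⟩ x
  obtain ⟨hyA, hys⟩ := hx y hy
  have h1 : ‖A x - A y‖ ≤ L * t Ω x := by
    rw [← hy, dist_eq_norm]; exact hL.norm_sub_le hxs hys
  have h2 : ‖A x‖ ≤ ‖A y‖ + ‖A x - A y‖ := by
    simpa using norm_add_le (A y) (A x - A y)
  have h3 : Metric.infDist y (Gam Ω) ≤ Metric.infDist x (Gam Ω) + t Ω x := by
    have := Metric.infDist_le_infDist_add_dist (s := Gam Ω) (x := y) (y := x)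
    rwa [dist_comm, hy] at this
  have ht0 : 0 ≤ t Ω x := Metric.infDist_nonneg
  have ht1 : t Ω x ≤ 1 :=
    (Metric.infDist_le_dist_of_mem hp.1).trans (Metric.mem_ball.1 hx1).le
  have hδ0 : 0 ≤ Metric.infDist y (Gam Ω) := Metric.infDist_nonneg
  have h4 : Metric.infDist y (Gam Ω) ^ 2 ≤ 2 * (t Ω x + Metric.infDist x (Gam Ω) ^ 2) := by
    have h5 := pow_le_pow_left₀ hδ0 h3 2
    nlinarith [sq_nonneg (Metric.infDist x (Gam Ω) - t Ω x)]
  have h6 := hyA hyf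
  have h7 := mul_le_mul_of_nonneg_left h4 hC
  have h8 : 0 ≤ (L : ℝ) * Metric.infDist x (Gam Ω) ^ 2 := by positivity
  nlinarith

lemma exists_contDiff_primitive {f : ℝ → ℝ} (hf : ContDiff ℝ ∞ f) :
    ∃ H : ℝ → ℝ, ContDiff ℝ ∞ H ∧ ∀ s, deriv H s = f s := by
  have hd : ∀ s, HasDerivAt (fun s => ∫ τ in (0 : ℝ)..s, f τ) (f s) s := fun s =>
    intervalIntegral.integral_hasDerivAt_right (hf.continuous.intervalIntegrable _ _)
      (hf.continuous.stronglyMeasurableAtFilter _ _) hf.continuous.continuousAt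
  refine ⟨_, ?_, fun s => (hd s).deriv⟩
  rw [contDiff_infty_iff_deriv]
  refine ⟨fun s => (hd s).differentiableAt, ?_⟩
  rwa [funext fun s => (hd s).deriv]

/-- A retraction moves a point at most proportionally to its distance to the curve. -/
lemma eventually_norm_sub_retraction_le {S : Set E3} (hS : IsCompact S) {p : E3} (hp : p ∈ S)
    {f : E3 → E3} (hf : ContDiff ℝ ∞ f) (hfS : ∀ᶠ x in 𝓝 p, x ∈ S → f x = x) :
    ∃ L, 0 ≤ L ∧ ∀ᶠ y in 𝓝 p, ‖y - f y‖ ≤ L * Metric.infDist y S := by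
  have h1 : ContDiffAt ℝ 1 (fun y => y - f y) p :=
    ((contDiff_id.sub hf).of_le (by simp)).contDiffAt
  obtain ⟨L, s, hs, hL⟩ := h1.exists_lipschitzOnWith
  have hs' : ∀ᶠ y in 𝓝 p, y ∈ s := hs
  refine ⟨L, L.2, ?_⟩
  filter_upwards [hs', eventually_of_closest hp (hs'.and hfS)] with y hy hz
  obtain ⟨z, hzS, hyz⟩ := hS.exists_infDist_eq_dist ⟨p, hp⟩ y
  obtain ⟨h2, h3⟩ := hz z hyz.symm
  have := hL.norm_sub_le hy h2
  simp only [h3 hzS, sub_self, sub_zero] at this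
  rwa [hyz, dist_eq_norm]

/-- The Taylor model built on the unit normal along the curve is a potential with the required
precision near a given point of the curve. -/
lemma exists_local_potential {Ω : Set E3} (hΩ : IsOpen Ω) (hb : Bornology.IsBounded Ω)
    (hs : HasSmoothBoundary Ω) (hΓ : IsRegularCurve (Gam Ω)) {p : E3} (hp : p ∈ Gam Ω) :
    ∃ φ : E3 → ℝ, ContDiff ℝ ∞ φ ∧ ∃ C, ∀ᶠ x in 𝓝 p,
      ‖F x + gradient φ x‖ ≤ C * (t Ω x + Metric.infDist x (Gam Ω) ^ 2) := by
  obtain ⟨U, ρ, hpU, h⟩ := hs p hp.1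
  obtain ⟨c, u, hc, hu, hup, hcS, hcu⟩ := hΓ.exists_chart hp
  have hc0 : c 0 = p := by rw [← hup]; exact hcu.self_of_nhds hp
  have hct : Tendsto c (𝓝 0) (𝓝 p) := hc.continuous.tendsto' 0 p hc0
  have hut : Tendsto u (𝓝 p) (𝓝 0) := hu.continuous.tendsto' p 0 hup
  -- the unit normal along the curve
  have hn : ContDiffOn ℝ ∞ (fun x => ‖gradient ρ x‖⁻¹ • gradient ρ x) U :=
    ((h.contDiffOn_gradient.norm ℝ h.gradient_ne_zero).inv
      fun x hx => norm_ne_zero_iff.2 (h.gradient_ne_zero x hx)).smul h.contDiffOn_gradient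
  obtain ⟨N, hN, hNeq⟩ := exists_contDiff_eventuallyEq
    (f := fun s => ‖gradient ρ (c s)‖⁻¹ • gradient ρ (c s)) (U := c ⁻¹' U) (p := (0 : ℝ))
    (h.isOpen.preimage hc.continuous) (hn.comp hc.contDiffOn fun s hs => hs)
    (by simpa [hc0] using hpU)
  -- the potential along the curve
  have hc' : ContDiff ℝ ∞ (deriv c) := (contDiff_infty_iff_deriv.1 hc).2
  have hN' : ContDiff ℝ ∞ (deriv N) := (contDiff_infty_iff_deriv.1 hN).2
  obtain ⟨H, hH, hH'⟩ := exists_contDiff_primitive ((contDiff_F.comp hc).inner ℝ hc').neg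
  have hφ := contDiff_taylorPotential hH hc hN hu
  refine ⟨_, hφ, ?_⟩
  obtain ⟨L, hL, hLd⟩ := eventually_norm_sub_retraction_le (isCompact_Gam hΩ hb hs) hp
    (hc.comp hu) hcu
  obtain ⟨CT, hCT, r, hr, hT⟩ := exists_taylor_bound (h.contDiffAt hpU)
  have hzero : ∀ᶠ s in 𝓝 (0 : ℝ), ρ (c s) = 0 ∧ (gradient ρ (c s)) 2 = 0 ∧ c s ∈ U ∧
      N s = ‖gradient ρ (c s)‖⁻¹ • gradient ρ (c s) := by
    filter_upwards [hcS, hct.eventually (h.isOpen.eventually_mem hpU), hNeq] with s h1 h2 h3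
    obtain ⟨h4, h5⟩ := (h.mem_Gam_iff hΩ h2).1 h1.1
    exact ⟨h4, by rwa [inner_beta] at h5, h2, h3⟩
  have hgpos : ‖gradient ρ p‖ ≠ 0 := norm_ne_zero_iff.2 (h.gradient_ne_zero p hpU)
  have hginv : ContinuousAt (fun s => ‖gradient ρ (c s)‖⁻¹) 0 := by
    have h1 : ContinuousAt (gradient ρ) (c 0) := by
      rw [hc0]
      exact h.contDiffOn_gradient.continuousOn.continuousAt (h.isOpen.mem_nhds hpU)
    exact (h1.comp hc.continuous.continuousAt).norm.inv₀ (by simpa [hc0] using hgpos)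
  set M₁ := ‖gradient ρ (c 0)‖⁻¹ + 1
  set M₂ := ‖deriv N 0‖ + 1
  set M₃ := ‖fderiv ℝ u p‖ + 1
  have hM₁ : 0 ≤ M₁ := by positivity
  have hM₂ : 0 ≤ M₂ := by positivity
  have hM₃ : 0 ≤ M₃ := by positivity
  have hcurve : ∀ᶠ s in 𝓝 (0 : ℝ), ρ (c s) = 0 ∧ c s ∈ Metric.ball p r ∧ c s ∈ U ∧ ‖N s‖ = 1 ∧
      N s 2 = 0 ∧ inner ℝ (N s) (deriv c s) = 0 ∧ ‖deriv N s‖ ≤ M₂ ∧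
      ∀ d, |inner ℝ (N s) d| ≤ M₁ * |inner ℝ (gradient ρ (c s)) d| := by
    filter_upwards [hzero, hzero.eventually_nhds, hct.eventually (Metric.ball_mem_nhds p hr),
      hginv.eventually (ge_mem_nhds (lt_add_one _)),
      hN'.continuous.norm.continuousAt.eventually (ge_mem_nhds (lt_add_one _))]
      with s ⟨h1, h2, h3, h4⟩ h5 h6 h7 h8
    have hg0 : ‖gradient ρ (c s)‖ ≠ 0 := norm_ne_zero_iff.2 (h.gradient_ne_zero _ h3)
    refine ⟨h1, h6, h3, ?_, ?_, ?_, h8, fun d => ?_⟩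
    · rw [h4, norm_smul, norm_inv, norm_norm, inv_mul_cancel₀ hg0]
    · rw [h4]; simp [h2]
    · have h9 : HasDerivAt (fun s => ρ (c s)) (inner ℝ (gradient ρ (c s)) (deriv c s)) s := by
        exact ((h.hasGradientAt h3).hasFDerivAt.comp_hasDerivAt s
          (hc.differentiable (by simp) s).hasDerivAt).congr_deriv (by simp)
      have h10 : HasDerivAt (fun s => ρ (c s)) 0 s :=
        (hasDerivAt_const s (0 : ℝ)).congr_of_eventuallyEq (h5.mono fun s hs => hs.1)
      rw [h4, real_inner_smul_left, h9.unique h10, mul_zero]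
    · rw [h4, real_inner_smul_left, abs_mul, abs_of_nonneg (by positivity)]
      exact mul_le_mul_of_nonneg_right h7 (abs_nonneg _)
  have hdc : ∀ᶠ y in 𝓝 p, ‖y - c (u y)‖ ≤ 1 := by
    have h1 : Continuous fun y => ‖y - c (u y)‖ :=
      (continuous_id.sub (hc.continuous.comp hu.continuous)).norm
    exact (h1.tendsto' p 0 (by simp [hup, hc0])).eventually (ge_mem_nhds one_pos)
  set K := M₁ * CT * (2 + M₃ * M₂) + M₃ * M₂ with hK
  have hK0 : 0 ≤ K := by positivity
  refine eventually_norm_le_of_frontier hb hp (C := K * L ^ 2) ?_ (by positivity) ?_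
  · have h1 : ContDiff ℝ ∞ (gradient (taylorPotential H c N u)) :=
      (InnerProductSpace.toDual ℝ E3).symm.toContinuousLinearEquiv.contDiff.comp
        (hφ.fderiv_right (m := ∞) (by simp))
    exact ((contDiff_F.add h1).of_le (by simp)).contDiffAt
  filter_upwards [hut.eventually hcurve, hLd, h.isOpen.eventually_mem hpU,
    Metric.ball_mem_nhds p hr, hdc, (hu.continuous_fderiv (by simp)).norm.continuousAt.eventually
        (ge_mem_nhds (lt_add_one _))]
    with y ⟨h1, h2, h3, h4, h5, h6, h7, h8⟩ hy1 hyU hyr hyd hyu hyf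
  have hρy := (h.mem_frontier_iff hΩ hyU).1 hyf
  have hT' := hT y hyr _ h2
  rw [hρy, h1, ← inner_gradient_left, sub_self, zero_sub, abs_neg] at hT'
  set d := y - c (u y) with hd
  have hA : ‖F y + gradient (taylorPotential H c N u) y‖ ≤ K * ‖d‖ ^ 2 := by
    set A := F y + gradient (taylorPotential H c N u) y with hA
    have hmain := inner_F_add_gradient_taylorPotential hH hc hN hu (hH' (u y)) h4 h5 h6 A
    rw [← hA, ← hd, real_inner_self_eq_norm_sq] at hmain
    have hFN : ∀ v, |inner ℝ (F (N (u y))) v| ≤ ‖v‖ := fun v => by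
      refine (abs_real_inner_le_norm _ _).trans ?_
      exact mul_le_of_le_one_left (norm_nonneg _) ((norm_F_le _).trans h4.le)
    have e1 : |inner ℝ (N (u y)) d| ≤ M₁ * CT * ‖d‖ ^ 2 :=
      (h8 d).trans (by rw [mul_assoc]; exact mul_le_mul_of_nonneg_left hT' hM₁)
    have e2 : |fderiv ℝ u y A| ≤ M₃ * ‖A‖ := by
      rw [← Real.norm_eq_abs]
      exact (ContinuousLinearMap.le_opNorm _ _).trans
        (mul_le_mul_of_nonneg_right hyu (norm_nonneg _))
    have e3 : |inner ℝ (F (deriv N (u y))) d| ≤ M₂ := by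
      refine (abs_real_inner_le_norm _ _).trans ?_
      calc _ ≤ M₂ * 1 := mul_le_mul ((norm_F_le _).trans h7) hyd (norm_nonneg _) hM₂
        _ = M₂ := mul_one _
    have e4 : |inner ℝ (deriv N (u y)) d| ≤ M₂ * ‖d‖ :=
      (abs_real_inner_le_norm _ _).trans (mul_le_mul_of_nonneg_right h7 (norm_nonneg _))
    have e5 : ‖A‖ ^ 2 ≤ K * ‖d‖ ^ 2 * ‖A‖ := by
      rw [hmain]
      refine (le_abs_self _).trans ((abs_add_le _ _).trans ?_)
      rw [abs_mul, abs_mul, abs_mul]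
      have f1 : |2 * inner ℝ (F (N (u y))) A +
          fderiv ℝ u y A * inner ℝ (F (deriv N (u y))) d| ≤ 2 * ‖A‖ + M₃ * ‖A‖ * M₂ := by
        refine (abs_add_le _ _).trans ?_
        rw [abs_mul, abs_mul, abs_two]
        exact add_le_add (mul_le_mul_of_nonneg_left (hFN A) zero_le_two)
          (mul_le_mul e2 e3 (abs_nonneg _) (by positivity))
      have f2 := mul_le_mul e1 f1 (abs_nonneg _) (by positivity)
      have f3 := mul_le_mul (mul_le_mul e2 e4 (abs_nonneg _) (by positivity)) (hFN d)
        (abs_nonneg _) (by positivity)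
      calc _ ≤ _ := add_le_add f2 f3
        _ = _ := by rw [hK]; ring
    rcases (norm_nonneg A).eq_or_lt with h0 | h0
    · rw [← h0]; positivity
    · rw [pow_two] at e5
      exact le_of_mul_le_mul_right e5 h0
  calc _ ≤ _ := hA
    _ ≤ K * (L * Metric.infDist y (Gam Ω)) ^ 2 := by
      refine mul_le_mul_of_nonneg_left ?_ hK0
      exact pow_le_pow_left₀ (norm_nonneg _) hy1 2
    _ = _ := by ring

/-! ### Unit speed curves in a regular curve -/

/-- `γ` is a `C¹` curve with values in `S` and unit speed, at the time `s`. -/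
def UnitSpeedAt (S : Set E3) (γ : ℝ → E3) (s : ℝ) : Prop :=
  γ s ∈ S ∧ ContDiffAt ℝ 1 γ s ∧ ‖deriv γ s‖ = 1

lemma UnitSpeedAt.hasDerivAt {S : Set E3} {γ : ℝ → E3} {s : ℝ} (h : UnitSpeedAt S γ s) :
    HasDerivAt γ (deriv γ s) s :=
  (h.2.1.differentiableAt (by simp)).hasDerivAt

lemma UnitSpeedAt.continuousAt {S : Set E3} {γ : ℝ → E3} {s : ℝ} (h : UnitSpeedAt S γ s) :
    ContinuousAt γ s := h.2.1.continuousAt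

lemma UnitSpeedAt.congr {S : Set E3} {γ γ' : ℝ → E3} {s : ℝ} (h : UnitSpeedAt S γ s)
    (he : γ' =ᶠ[𝓝 s] γ) : UnitSpeedAt S γ' s :=
  ⟨by rw [he.self_of_nhds]; exact h.1, h.2.1.congr_of_eventuallyEq he,
    by rw [he.deriv_eq]; exact h.2.2⟩

lemma UnitSpeedAt.comp_affine {S : Set E3} {γ : ℝ → E3} {k e s : ℝ} (he : e = 1 ∨ e = -1)
    (h : UnitSpeedAt S γ (k + e * s)) : UnitSpeedAt S (fun v => γ (k + e * v)) s := by
  have hd : HasDerivAt (fun v => k + e * v) e s := by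
    simpa using ((hasDerivAt_id s).const_mul e).const_add k
  have hd' := h.hasDerivAt.scomp s hd
  refine ⟨h.1, ContDiffAt.comp s h.2.1 (by fun_prop), ?_⟩
  change ‖deriv (γ ∘ fun v => k + e * v) s‖ = 1
  rw [hd'.deriv, norm_smul, h.2.2]
  rcases he with rfl | rfl <;> simp

lemma abs_sign_mul {e : ℝ} (he : e = 1 ∨ e = -1) (v : ℝ) : |e * v| = |v| := by
  rcases he with rfl | rfl <;> simp

lemma sign_mul_self {e : ℝ} (he : e = 1 ∨ e = -1) : e * e = 1 := by
  rcases he with rfl | rfl <;> simp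

/-- An arc length chart of `S` centred at `p`: in the open set `V`, the set `S` is the image of a
unit speed curve `c` on `(-r, r)`, whose inverse extends to a differentiable function `a`. -/
structure IsUnitChart (S : Set E3) (p : E3) (c : ℝ → E3) (a : E3 → ℝ) (V : Set E3) (r : ℝ) :
    Prop where
  pos : 0 < r
  le_one : r ≤ 1
  isOpen : IsOpen V
  mem : p ∈ V
  map_zero : c 0 = p
  unitSpeed : ∀ v, |v| < r → UnitSpeedAt S c v
  left_inv : ∀ v, |v| < r → c v ∈ V ∧ a (c v) = v
  right_inv : ∀ x ∈ V, x ∈ S → |a x| < r ∧ c (a x) = x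
  differentiableAt : ∀ x ∈ V, DifferentiableAt ℝ a x

lemma IsRegularCurve.exists_isUnitChart {S : Set E3} (hS : IsRegularCurve S) {p : E3}
    (hp : p ∈ S) : ∃ c a V r, IsUnitChart S p c a V r := by
  obtain ⟨c, u, hc, hu, hup, hcS, hcu⟩ := hS.exists_chart hp
  have hc0 : c 0 = p := by rw [← hup]; exact hcu.self_of_nhds hp
  -- the speed of `c` does not vanish, as `u ∘ c` is the identity
  have hspeed : ∀ᶠ s in 𝓝 (0 : ℝ), c s ∈ S ∧ u (c s) = s ∧ deriv c s ≠ 0 := by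
    filter_upwards [hcS, hcS.eventually_nhds] with s h1 h2
    refine ⟨h1.1, h1.2, fun h0 => ?_⟩
    have h3 := (hu.differentiable (by simp) (c s)).hasFDerivAt.comp_hasDerivAt s
      (hc.differentiable (by simp) s).hasDerivAt
    have h4 : HasDerivAt (u ∘ c) 1 s :=
      (hasDerivAt_id s).congr_of_eventuallyEq (h2.mono fun s hs => hs.2)
    have h5 := h3.unique h4
    rw [h0, map_zero] at h5
    exact zero_ne_one h5
  have hc' : Continuous (fun s => ‖deriv c s‖) := (hc.continuous_deriv (by simp)).norm
  -- the arc length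
  set σ : ℝ → ℝ := fun s => ∫ τ in (0 : ℝ)..s, ‖deriv c τ‖ with hσ
  have hσd : ∀ s, HasDerivAt σ ‖deriv c s‖ s := fun s =>
    intervalIntegral.integral_hasDerivAt_right (hc'.intervalIntegrable _ _)
      (hc'.stronglyMeasurableAtFilter _ _) hc'.continuousAt
  have hσc : ContDiff ℝ 1 σ := by
    rw [contDiff_one_iff_deriv]
    exact ⟨fun s => (hσd s).differentiableAt, by rwa [funext fun s => (hσd s).deriv]⟩
  have hσ0 : σ 0 = 0 := by simp [hσ]
  have h0 : ‖deriv c 0‖ ≠ 0 := norm_ne_zero_iff.2 hspeed.self_of_nhds.2.2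
  have hstrict : HasStrictDerivAt σ ‖deriv c 0‖ 0 := by
    simpa [(hσd 0).deriv] using hσc.contDiffAt.hasStrictDerivAt (x := (0 : ℝ)) one_ne_zero
  set e := (hstrict.hasStrictFDerivAt_equiv h0).toOpenPartialHomeomorph σ with he
  have heσ : ∀ s, e s = σ s := fun s => rfl
  have hes : (0 : ℝ) ∈ e.source :=
    (hstrict.hasStrictFDerivAt_equiv h0).mem_toOpenPartialHomeomorph_source
  have het : (0 : ℝ) ∈ e.target := by simpa [heσ, hσ0] using e.map_source hes
  have hsymm0 : e.symm 0 = 0 := by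
    simpa [heσ, hσ0] using e.left_inv hes
  have hconts : ContinuousAt e.symm 0 := e.continuousAt_symm het
  obtain ⟨V₀, hV₀, hV₀o, hpV₀⟩ := mem_nhds_iff.1 hcu
  have hW : ∀ᶠ s in 𝓝 (0 : ℝ), s ∈ e.source ∧ c s ∈ V₀ ∧ c s ∈ S ∧ u (c s) = s ∧
      deriv c s ≠ 0 :=
    (e.open_source.eventually_mem hes).and
      (((hc.continuous.tendsto' 0 p hc0).eventually (hV₀o.eventually_mem hpV₀)).and hspeed)
  obtain ⟨W, hWprop, hWo, h0W⟩ := eventually_nhds_iff.1 hW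
  have hr : ∀ᶠ τ in 𝓝 (0 : ℝ), τ ∈ e.target ∧ e.symm τ ∈ W :=
    (e.open_target.eventually_mem het).and
      (hconts.eventually (by rw [hsymm0]; exact hWo.mem_nhds h0W))
  obtain ⟨r, hr0, hr⟩ := Metric.eventually_nhds_iff.1 hr
  refine ⟨fun τ => c (e.symm τ), fun x => σ (u x),
    V₀ ∩ {x | |σ (u x)| < min r 1} ∩ u ⁻¹' W, min r 1, ⟨lt_min hr0 one_pos, min_le_right _ _,
    ?_, ⟨⟨hpV₀, ?_⟩, ?_⟩, ?_, ?_, ?_, ?_, ?_⟩⟩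
  · refine (hV₀o.inter ?_).inter (hWo.preimage hu.continuous)
    exact isOpen_lt (hσc.continuous.comp hu.continuous).abs continuous_const
  · simp [hup, hσ0, hr0]
  · simpa [hup] using h0W
  · simp [hsymm0, hc0]
  · intro τ hτ
    obtain ⟨hτt, hτW⟩ := hr (y := τ) (by simpa using lt_of_lt_of_le hτ (min_le_left _ _))
    obtain ⟨k1, k2, k3, k4, k5⟩ := hWprop _ hτW
    have hne : ‖deriv c (e.symm τ)‖ ≠ 0 := norm_ne_zero_iff.2 k5
    have hd1 : HasDerivAt e.symm (‖deriv c (e.symm τ)‖)⁻¹ τ :=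
      e.hasDerivAt_symm hτt hne (hσd _)
    have hd2 : ContDiffAt ℝ 1 e.symm τ :=
      e.contDiffAt_symm_deriv hne hτt (hσd _) hσc.contDiffAt
    refine ⟨k3, ContDiffAt.comp τ (hc.of_le (by simp)).contDiffAt hd2, ?_⟩
    have hd3 := (hc.differentiable (by simp) (e.symm τ)).hasDerivAt.scomp τ hd1
    change ‖deriv (c ∘ e.symm) τ‖ = 1
    rw [hd3.deriv, norm_smul, norm_inv, norm_norm, inv_mul_cancel₀ hne]
  · intro τ hτ
    obtain ⟨hτt, hτW⟩ := hr (y := τ) (by simpa using lt_of_lt_of_le hτ (min_le_left _ _))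
    obtain ⟨k1, k2, k3, k4, k5⟩ := hWprop _ hτW
    have hτσ : σ (u (c (e.symm τ))) = τ := by rw [k4, ← heσ, e.right_inv hτt]
    refine ⟨⟨⟨k2, ?_⟩, ?_⟩, hτσ⟩
    · change |σ (u (c (e.symm τ)))| < min r 1; rwa [hτσ]
    · change u (c (e.symm τ)) ∈ W; rwa [k4]
  · rintro x ⟨⟨h1, h2⟩, h3⟩ hxS
    refine ⟨h2, ?_⟩
    rw [← heσ, e.left_inv (hWprop _ h3).1]
    exact hV₀ h1 hxS
  · intro x _
    exact (hσd _).differentiableAt.comp x (hu.differentiable (by simp) x)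

/-- In an arc length chart, a unit speed curve is a translate of the chart curve, up to the
direction: the derivative of its arc length coordinate is `±1`, with constant sign because
derivatives have the intermediate value property. -/
lemma IsUnitChart.exists_affine {S : Set E3} {p : E3} {c : ℝ → E3} {a : E3 → ℝ} {V : Set E3}
    {r : ℝ} (h : IsUnitChart S p c a V r) {γ : ℝ → E3} {A B : ℝ}
    (hγ : ∀ s ∈ Ioo A B, UnitSpeedAt S γ s ∧ γ s ∈ V) :
    ∃ e k : ℝ, (e = 1 ∨ e = -1) ∧ ∀ s ∈ Ioo A B, a (γ s) = k + e * s := by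
  have hd : ∀ s ∈ Ioo A B, HasDerivAt (fun s => a (γ s)) (fderiv ℝ a (γ s) (deriv γ s)) s :=
    fun s hs => (h.differentiableAt _ (hγ s hs).2).hasFDerivAt.comp_hasDerivAt s
      (hγ s hs).1.hasDerivAt
  have habs : ∀ s ∈ Ioo A B, |fderiv ℝ a (γ s) (deriv γ s)| = 1 := by
    intro s hs
    obtain ⟨h1, h2⟩ := h.right_inv _ (hγ s hs).2 (hγ s hs).1.1
    have h3 := (h.unitSpeed _ h1).hasDerivAt.scomp s (hd s hs)
    have h4 : γ =ᶠ[𝓝 s] c ∘ fun s => a (γ s) := by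
      filter_upwards [isOpen_Ioo.mem_nhds hs] with s' hs'
      exact (h.right_inv _ (hγ s' hs').2 (hγ s' hs').1.1).2.symm
    have h5 := ((hγ s hs).1.hasDerivAt.congr_of_eventuallyEq h4.symm).unique h3
    have h6 := congrArg norm h5
    rw [(hγ s hs).1.2.2, norm_smul, (h.unitSpeed _ h1).2.2, mul_one, Real.norm_eq_abs] at h6
    exact h6.symm
  have hsign : ∃ e : ℝ, (e = 1 ∨ e = -1) ∧
      ∀ s ∈ Ioo A B, fderiv ℝ a (γ s) (deriv γ s) = e := by
    rcases hasDerivWithinAt_forall_lt_or_forall_gt_of_forall_ne (convex_Ioo A B) (m := 0)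
      (fun s hs => (hd s hs).hasDerivWithinAt)
      (fun s hs h0 => by have := habs s hs; rw [h0] at this; simp at this) with hs | hs
    · refine ⟨-1, Or.inr rfl, fun s hs' => ?_⟩
      have := habs s hs'
      rw [abs_of_neg (hs s hs')] at this
      linarith
    · refine ⟨1, Or.inl rfl, fun s hs' => ?_⟩
      have := habs s hs'
      rwa [abs_of_pos (hs s hs')] at this
  obtain ⟨e, he, hde⟩ := hsign
  have hzero : ∀ s ∈ Ioo A B, HasDerivAt (fun s => a (γ s) - e * s) 0 s := by
    intro s hs
    have h1 := (hd s hs).sub ((hasDerivAt_id s).const_mul e)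
    rw [hde s hs, mul_one, sub_self] at h1
    exact h1
  obtain ⟨k, hk⟩ := isOpen_Ioo.exists_is_const_of_deriv_eq_zero isPreconnected_Ioo
    (fun s hs => (hzero s hs).differentiableAt.differentiableWithinAt)
    (fun s hs => (hzero s hs).deriv)
  exact ⟨e, k, he, fun s hs => by linarith [hk s hs]⟩

lemma exists_Ioo_of_eventually {P : ℝ → Prop} {s : ℝ} (h : ∀ᶠ x in 𝓝 s, P x) :
    ∃ η > 0, ∀ x ∈ Ioo (s - η) (s + η), P x := by
  obtain ⟨η, hη, h⟩ := Metric.eventually_nhds_iff_ball.1 h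
  exact ⟨η, hη, by rwa [Real.ball_eq_Ioo] at h⟩

lemma tendsto_sign_mul (e : ℝ) : Tendsto (fun v : ℝ => e * v) (𝓝 0) (𝓝 0) :=
  (continuous_const_mul e).tendsto' 0 0 (mul_zero e)

lemma tendsto_add_right (s : ℝ) : Tendsto (fun v : ℝ => s + v) (𝓝 0) (𝓝 s) :=
  (continuous_const.add continuous_id).tendsto' 0 s (add_zero s)

lemma IsUnitChart.eventually_eq {S : Set E3} {p : E3} {c : ℝ → E3} {a : E3 → ℝ} {V : Set E3}
    {r : ℝ} (h : IsUnitChart S p c a V r) {γ : ℝ → E3} {s : ℝ}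
    (hγ : ∀ᶠ v in 𝓝 s, UnitSpeedAt S γ v) (hp : γ s = p) :
    ∃ e : ℝ, (e = 1 ∨ e = -1) ∧ ∀ᶠ v in 𝓝 0, γ (s + v) = c (e * v) := by
  have h1 : ∀ᶠ v in 𝓝 s, UnitSpeedAt S γ v ∧ γ v ∈ V :=
    hγ.and (hγ.self_of_nhds.continuousAt.eventually
      (by rw [hp]; exact h.isOpen.mem_nhds h.mem))
  obtain ⟨η, hη, h2⟩ := exists_Ioo_of_eventually h1
  obtain ⟨e, k, he, h3⟩ := h.exists_affine h2
  have hs : s ∈ Ioo (s - η) (s + η) := ⟨by linarith, by linarith⟩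
  have h0 : a p = 0 := by
    have := (h.left_inv 0 (by simpa using h.pos)).2
    rwa [h.map_zero] at this
  have h4 := h3 s hs
  rw [hp, h0] at h4
  refine ⟨e, he, ?_⟩
  filter_upwards [(tendsto_add_right s).eventually (isOpen_Ioo.eventually_mem hs)] with v hv
  rw [← (h.right_inv _ (h2 _ hv).2 (h2 _ hv).1.1).2, h3 _ hv]
  congr 1
  linarith

/-- Two unit speed curves through the same point agree near this point, up to the direction. -/
lemma IsRegularCurve.unitSpeed_compare {S : Set E3} (hS : IsRegularCurve S) {γ γ' : ℝ → E3}
    {s s' : ℝ} (hγ : ∀ᶠ v in 𝓝 s, UnitSpeedAt S γ v) (hγ' : ∀ᶠ v in 𝓝 s', UnitSpeedAt S γ' v)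
    (h : γ s = γ' s') :
    ∃ e : ℝ, (e = 1 ∨ e = -1) ∧ ∀ᶠ v in 𝓝 0, γ (s + v) = γ' (s' + e * v) := by
  obtain ⟨c, a, V, r, hch⟩ := hS.exists_isUnitChart hγ'.self_of_nhds.1
  obtain ⟨e, he, h1⟩ := hch.eventually_eq hγ h
  obtain ⟨e', he', h2⟩ := hch.eventually_eq hγ' rfl
  refine ⟨e' * e, by rcases he with rfl | rfl <;> rcases he' with rfl | rfl <;> simp, ?_⟩
  filter_upwards [h1, (tendsto_sign_mul (e' * e)).eventually h2] with v h3 h4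
  rw [h3, h4, ← mul_assoc, ← mul_assoc, sign_mul_self he', one_mul]

/-- Unit speed curves in `S` are locally injective. -/
lemma IsRegularCurve.unitSpeed_locally_injective {S : Set E3} (hS : IsRegularCurve S) {γ : ℝ → E3}
    {s : ℝ} (hγ : ∀ᶠ v in 𝓝 s, UnitSpeedAt S γ v) :
    ∃ η > 0, ∀ v w, |v| < η → |w| < η → γ (s + v) = γ (s + w) → v = w := by
  obtain ⟨c, a, V, r, hch⟩ := hS.exists_isUnitChart hγ.self_of_nhds.1
  obtain ⟨e, he, h1⟩ := hch.eventually_eq hγ rfl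
  obtain ⟨η, hη, h2⟩ := Metric.eventually_nhds_iff.1 h1
  refine ⟨min η r, lt_min hη hch.pos, fun v w hv hw hvw => ?_⟩
  rw [h2 (by simpa using lt_of_lt_of_le hv (min_le_left _ _)),
    h2 (by simpa using lt_of_lt_of_le hw (min_le_left _ _))] at hvw
  have h3 := congrArg a hvw
  rw [(hch.left_inv _ (by rw [abs_sign_mul he]; exact lt_of_lt_of_le hv (min_le_right _ _))).2,
    (hch.left_inv _ (by rw [abs_sign_mul he]; exact lt_of_lt_of_le hw (min_le_right _ _))).2] at h3
  rcases he with rfl | rfl <;> linarith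

/-- Unit speed curves in `S` are open maps into `S`. -/
lemma IsRegularCurve.unitSpeed_open {S : Set E3} (hS : IsRegularCurve S) {γ : ℝ → E3}
    {s : ℝ} (hγ : ∀ᶠ v in 𝓝 s, UnitSpeedAt S γ v) {η : ℝ} (hη : 0 < η) :
    ∀ᶠ x in 𝓝 (γ s), x ∈ S → x ∈ γ '' Ioo (s - η) (s + η) := by
  obtain ⟨c, a, V, r, hch⟩ := hS.exists_isUnitChart hγ.self_of_nhds.1
  obtain ⟨e, he, h1⟩ := hch.eventually_eq hγ rfl
  have h0 : a (γ s) = 0 := by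
    have := (hch.left_inv 0 (by simpa using hch.pos)).2
    rwa [hch.map_zero] at this
  have ha : Tendsto (fun x => e * a x) (𝓝 (γ s)) (𝓝 0) := by
    have := (hch.differentiableAt _ hch.mem).continuousAt.tendsto
    rw [h0] at this
    simpa using this.const_mul e
  filter_upwards [ha.eventually h1, hch.isOpen.eventually_mem hch.mem,
    ha.eventually (Metric.ball_mem_nhds 0 hη)] with x h2 h3 h4 hxS
  rw [dist_zero_right, Real.norm_eq_abs, abs_lt] at h4
  refine ⟨s + e * a x, ⟨by linarith [h4.1], by linarith [h4.2]⟩, ?_⟩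
  rw [h2, ← mul_assoc, sign_mul_self he, one_mul]
  exact (hch.right_inv x h3 hxS).2

/-- Unit speed curves that agree near one time agree on any common interval of definition. -/
lemma IsRegularCurve.unitSpeed_eqOn {S : Set E3} (hS : IsRegularCurve S) {γ γ' : ℝ → E3}
    {A B s : ℝ} (hγ : ∀ v ∈ Ioo A B, UnitSpeedAt S γ v)
    (hγ' : ∀ v ∈ Ioo A B, UnitSpeedAt S γ' v) (hs : s ∈ Ioo A B) (h : γ =ᶠ[𝓝 s] γ') :
    EqOn γ γ' (Ioo A B) := by
  have hsub : Ioo A B ⊆ {v | γ =ᶠ[𝓝 v] γ'} := by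
    refine isPreconnected_Ioo.subset_of_closure_inter_subset isOpen_setOfPred_eventually_nhds
      ⟨s, hs, h⟩ ?_
    rintro v ⟨hvc, hv⟩
    by_contra hvW
    have heq : γ v = γ' v := by
      by_contra hne
      obtain ⟨w, hw1, hw2⟩ := mem_closure_iff_nhds.1 hvc _
        (((hγ v hv).continuousAt.sub (hγ' v hv).continuousAt).eventually_ne (sub_ne_zero.2 hne))
      exact hw1 (sub_eq_zero.2 hw2.self_of_nhds)
    have hγe : ∀ᶠ w in 𝓝 v, UnitSpeedAt S γ w := by
      filter_upwards [isOpen_Ioo.mem_nhds hv] with w hw using hγ w hw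
    have hγe' : ∀ᶠ w in 𝓝 v, UnitSpeedAt S γ' w := by
      filter_upwards [isOpen_Ioo.mem_nhds hv] with w hw using hγ' w hw
    obtain ⟨e, he, h1⟩ := hS.unitSpeed_compare hγe hγe' heq
    have hback : Tendsto (fun w : ℝ => w - v) (𝓝 v) (𝓝 0) :=
      (continuous_id.sub continuous_const).tendsto' v 0 (sub_self v)
    obtain ⟨η, hη, hinj⟩ := hS.unitSpeed_locally_injective hγe'
    obtain ⟨w, ⟨hw1, hw2⟩, hw3⟩ := mem_closure_iff_nhds.1 hvc _
      ((hback.eventually h1).and (hback.eventually (Metric.ball_mem_nhds 0 hη)))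
    have hw2' : |w - v| < η := by simpa using hw2
    have hne : w - v ≠ 0 := by
      intro h0
      rw [sub_eq_zero] at h0
      exact hvW (h0 ▸ hw3)
    have h2 : γ' (v + (w - v)) = γ' (v + e * (w - v)) := by
      rw [← hw1]
      simpa using hw3.self_of_nhds.symm
    have h3 := hinj _ _ hw2' (by rwa [abs_sign_mul he]) h2
    have he1 : e = 1 := by
      rcases he with rfl | rfl
      · rfl
      · exact absurd (by linarith : w - v = 0) hne
    subst he1
    refine hvW ?_
    filter_upwards [hback.eventually h1] with w hw
    simpa using hw
  exact fun v hv => (hsub hv).self_of_nhds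

/-! ### Closed unit speed parametrizations -/

lemma eventually_unitSpeedAt {S : Set E3} {γ : ℝ → E3} {A B s : ℝ}
    (hγ : ∀ v ∈ Ioo A B, UnitSpeedAt S γ v) (hs : s ∈ Ioo A B) :
    ∀ᶠ v in 𝓝 s, UnitSpeedAt S γ v := by
  filter_upwards [isOpen_Ioo.mem_nhds hs] with v hv using hγ v hv

lemma tendsto_sub_self (s : ℝ) : Tendsto (fun v : ℝ => v - s) (𝓝 s) (𝓝 0) :=
  (continuous_id.sub continuous_const).tendsto' s 0 (sub_self s)

/-- If a unit speed curve passes through the same point twice, it does so in the same direction: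
otherwise it would be symmetric about the middle time, where it would not be injective. Hence it
repeats itself. -/
lemma IsRegularCurve.unitSpeed_translate {S : Set E3} (hS : IsRegularCurve S) {γ : ℝ → E3}
    {A B : ℝ} (hγ : ∀ v ∈ Ioo A B, UnitSpeedAt S γ v) {a b : ℝ} (ha : a ∈ Ioo A B)
    (hb : b ∈ Ioo A B) (hab : a < b) (h : γ a = γ b) {v : ℝ} (hav : a + v ∈ Ioo A B)
    (hbv : b + v ∈ Ioo A B) : γ (a + v) = γ (b + v) := by
  obtain ⟨e, he, h1⟩ := hS.unitSpeed_compare (eventually_unitSpeedAt hγ ha)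
    (eventually_unitSpeedAt hγ hb) h
  have h2 : ∀ᶠ w in 𝓝 a, γ w = γ (b + e * (w - a)) := by
    filter_upwards [(tendsto_sub_self a).eventually h1] with w hw
    simpa using hw
  obtain ⟨hA, hB⟩ := ha
  obtain ⟨hA', hB'⟩ := hb
  rcases he with rfl | rfl
  · have hc : ∀ w ∈ Ioo A (B - (b - a)), UnitSpeedAt S (fun w => γ ((b - a) + 1 * w)) w :=
      fun w hw => (hγ _ ⟨by linarith [hw.1], by linarith [hw.2]⟩).comp_affine (Or.inl rfl)
    have h3 := hS.unitSpeed_eqOn (s := a) (fun w hw => hγ w ⟨hw.1, by linarith [hw.2]⟩) hc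
      ⟨hA, by linarith⟩ (by
        filter_upwards [h2] with w hw
        rw [hw]; congr 1; ring)
    have h4 := h3 (x := a + v) ⟨hav.1, by linarith [hbv.2]⟩
    exact h4.trans (congrArg γ (by ring))
  · exfalso
    have hc : ∀ w ∈ Ioo (max A (a + b - B)) (min B (a + b - A)),
        UnitSpeedAt S (fun w => γ ((a + b) + (-1) * w)) w := fun w hw => by
      have k1 := lt_of_le_of_lt (le_max_right _ _) hw.1
      have k2 := lt_of_lt_of_le hw.2 (min_le_right _ _)
      exact (hγ _ ⟨by linarith, by linarith⟩).comp_affine (Or.inr rfl)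
    have h3 := hS.unitSpeed_eqOn (s := a) (fun w hw => hγ w
        ⟨lt_of_le_of_lt (le_max_left _ _) hw.1, lt_of_lt_of_le hw.2 (min_le_left _ _)⟩) hc
      ⟨max_lt hA (by linarith), lt_min hB (by linarith)⟩ (by
        filter_upwards [h2] with w hw
        rw [hw]; congr 1; ring)
    set m := (a + b) / 2 with hm
    have hmI : m ∈ Ioo (max A (a + b - B)) (min B (a + b - A)) :=
      ⟨max_lt (by linarith) (by linarith), lt_min (by linarith) (by linarith)⟩
    obtain ⟨η, hη, hinj⟩ := hS.unitSpeed_locally_injective (s := m)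
      (eventually_unitSpeedAt hγ ⟨by linarith, by linarith⟩)
    obtain ⟨η', hη', hsub⟩ := exists_Ioo_of_eventually (isOpen_Ioo.eventually_mem hmI)
    set w := min η η' / 2 with hw
    have hw0 : 0 < w := by positivity
    have hw1 : w < η := by linarith [min_le_left η η']
    have hw2 : w < η' := by linarith [min_le_right η η']
    have h4 := h3 (hsub (m + w) ⟨by linarith, by linarith⟩)
    have h5 : γ (m + w) = γ (m + -w) := h4.trans (congrArg γ (by linarith))
    have := hinj w (-w) (by rwa [abs_of_pos hw0]) (by rwa [abs_neg, abs_of_pos hw0]) h5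
    linarith

/-- On a compact regular curve, unit speed curves exist for a time independent of the starting
point. -/
lemma IsRegularCurve.exists_uniform_time {S : Set E3} (hS : IsRegularCurve S) (hc : IsCompact S) :
    ∃ δ > 0, ∀ q ∈ S, ∃ γ : ℝ → E3, γ 0 = q ∧ ∀ v ∈ Ioo (-δ) δ, UnitSpeedAt S γ v := by
  have key : ∃ δ > 0, ∀ q ∈ S, q ∈ S → ∃ γ : ℝ → E3, γ 0 = q ∧
      ∀ v ∈ Ioo (-δ) δ, UnitSpeedAt S γ v := by
    refine hc.induction_on (p := fun K => ∃ δ > 0, ∀ q ∈ K, q ∈ S → ∃ γ : ℝ → E3, γ 0 = q ∧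
      ∀ v ∈ Ioo (-δ) δ, UnitSpeedAt S γ v) ⟨1, one_pos, by simp⟩ ?_ ?_ ?_
    · rintro K K' hK ⟨δ, hδ, h⟩
      exact ⟨δ, hδ, fun q hq => h q (hK hq)⟩
    · rintro K K' ⟨δ, hδ, h⟩ ⟨δ', hδ', h'⟩
      refine ⟨min δ δ', lt_min hδ hδ', fun q hq hqS => ?_⟩
      rcases hq with hq | hq
      · obtain ⟨γ, h1, h2⟩ := h q hq hqS
        exact ⟨γ, h1, fun v hv => h2 v ⟨by linarith [hv.1, min_le_left δ δ'],
          by linarith [hv.2, min_le_left δ δ']⟩⟩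
      · obtain ⟨γ, h1, h2⟩ := h' q hq hqS
        exact ⟨γ, h1, fun v hv => h2 v ⟨by linarith [hv.1, min_le_right δ δ'],
          by linarith [hv.2, min_le_right δ δ']⟩⟩
    · intro p hp
      obtain ⟨c, a, V, r, hch⟩ := hS.exists_isUnitChart hp
      have h0 : a p = 0 := by
        have := (hch.left_inv 0 (by simpa using hch.pos)).2
        rwa [hch.map_zero] at this
      have hr := hch.pos
      refine ⟨{x | x ∈ V ∧ |a x| < r / 2}, nhdsWithin_le_nhds ?_, r / 2, by positivity, ?_⟩
      · have h1 : Tendsto (fun x => |a x|) (𝓝 p) (𝓝 0) := by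
          have := (hch.differentiableAt _ hch.mem).continuousAt.abs.tendsto
          rwa [h0, abs_zero] at this
        exact (hch.isOpen.eventually_mem hch.mem).and (h1.eventually (gt_mem_nhds (by positivity)))
      · rintro q ⟨hqV, hqa⟩ hqS
        refine ⟨fun v => c (a q + 1 * v), ?_, fun v hv => UnitSpeedAt.comp_affine (Or.inl rfl)
          (hch.unitSpeed _ ?_)⟩
        · simpa using (hch.right_inv q hqV hqS).2
        · rw [abs_lt] at hqa ⊢
          constructor <;> linarith [hv.1, hv.2, hqa.1, hqa.2]
  obtain ⟨δ, hδ, h⟩ := key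
  exact ⟨δ, hδ, fun q hq => h q hq hq⟩

lemma IsRegularCurve.exists_unitSpeed {S : Set E3} (hS : IsRegularCurve S) (hc : IsCompact S) :
    ∃ δ > 0, ∀ q ∈ S, ∀ T, ∃ γ : ℝ → E3, γ 0 = q ∧ ∀ v ∈ Ioo (-δ) T, UnitSpeedAt S γ v := by
  obtain ⟨δ, hδ, hex⟩ := hS.exists_uniform_time hc
  refine ⟨δ, hδ, fun q hq T => ?_⟩
  have hn : ∀ n : ℕ, ∃ γ : ℝ → E3, γ 0 = q ∧
      ∀ v ∈ Ioo (-δ) (δ + n * (δ / 2)), UnitSpeedAt S γ v := by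
    intro n
    induction n with
    | zero => simpa using hex q hq
    | succ n ih =>
      obtain ⟨γ, h0, hγ⟩ := ih
      have hnδ : 0 ≤ n * (δ / 2) := by positivity
      -- continue `γ` at the time `s` by a curve that exists for the time `δ`
      set s := n * (δ / 2) + δ / 2 with hs
      have hsI : s ∈ Ioo (-δ) (δ + n * (δ / 2)) := ⟨by linarith, by linarith⟩
      obtain ⟨γ', h0', hγ'⟩ := hex (γ s) (hγ s hsI).1
      obtain ⟨e, he, h1⟩ := hS.unitSpeed_compare (eventually_unitSpeedAt hγ hsI)
        (eventually_unitSpeedAt (s := 0) hγ' ⟨by linarith, by linarith⟩) h0'.symm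
      have h2 : ∀ᶠ w in 𝓝 s, γ w = γ' (-(e * s) + e * w) := by
        filter_upwards [(tendsto_sub_self s).eventually h1] with w hw
        rw [add_sub_cancel] at hw
        rw [hw]; congr 1; ring
      refine ⟨fun w => if w ≤ s then γ w else γ' (-(e * s) + e * w), ?_, fun v hv => ?_⟩
      · exact (if_pos (show (0 : ℝ) ≤ s by linarith)).trans h0
      · rw [Nat.cast_succ] at hv
        rcases lt_trichotomy v s with hvs | rfl | hvs
        · refine (hγ v ⟨hv.1, by linarith [hsI.2]⟩).congr ?_
          filter_upwards [gt_mem_nhds hvs] with w hw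
          rw [if_pos (le_of_lt hw)]
        · refine (hγ _ hsI).congr ?_
          filter_upwards [h2] with w hw
          split_ifs
          · rfl
          · exact hw.symm
        · have h3 : |e * (v - s)| < δ := by
            rw [abs_sign_mul he, abs_of_pos (by linarith)]
            linarith [hv.2]
          rw [abs_lt] at h3
          have h4 : UnitSpeedAt S γ' (-(e * s) + e * v) := hγ' _ ⟨by linarith, by linarith⟩
          refine (h4.comp_affine he).congr ?_
          filter_upwards [lt_mem_nhds hvs] with w hw
          rw [if_neg (not_le.2 hw)]
  obtain ⟨n, hn'⟩ := exists_nat_gt (T / (δ / 2))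
  obtain ⟨γ, h0, hγ⟩ := hn n
  rw [div_lt_iff₀ (by positivity)] at hn'
  exact ⟨γ, h0, fun v hv => hγ v ⟨hv.1, by linarith [hv.2]⟩⟩

/-- A unit speed curve that meets an arc length chart (whose radius is at most `1`) passes through
every point of `S` in the chart in the time `2`. -/
lemma IsUnitChart.exists_passage {S : Set E3} (hS : IsRegularCurve S) {p : E3} {c : ℝ → E3}
    {a : E3 → ℝ} {V : Set E3} {r : ℝ} (h : IsUnitChart S p c a V r) {γ : ℝ → E3} {s : ℝ}
    (hγ : ∀ v ∈ Ioo (s - 2) (s + 2), UnitSpeedAt S γ v) (hs : γ s ∈ V) {q : E3} (hqS : q ∈ S)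
    (hqV : q ∈ V) : ∃ v ∈ Ioo (s - 2) (s + 2), γ v = q := by
  have hsI : s ∈ Ioo (s - 2) (s + 2) := ⟨by linarith, by linarith⟩
  obtain ⟨h1, h2⟩ := h.right_inv _ hs (hγ s hsI).1
  obtain ⟨h3, h4⟩ := h.right_inv q hqV hqS
  have hc : ∀ v ∈ Ioo (-r) r, UnitSpeedAt S c v := fun v hv => h.unitSpeed v (abs_lt.2 hv)
  obtain ⟨e, he, h5⟩ := hS.unitSpeed_compare (eventually_unitSpeedAt hc (abs_lt.1 h1))
    (eventually_unitSpeedAt hγ hsI) h2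
  have h6 : ∀ᶠ w in 𝓝 (a (γ s)), c w = γ ((s - e * a (γ s)) + e * w) := by
    filter_upwards [(tendsto_sub_self (a (γ s))).eventually h5] with w hw
    rw [add_sub_cancel] at hw
    rw [hw]; congr 1; ring
  have hr := h.le_one
  have hmem : ∀ w ∈ Ioo (-r) r, (s - e * a (γ s)) + e * w ∈ Ioo (s - 2) (s + 2) := by
    intro w hw
    rw [abs_lt] at h1
    have h7 : |e * (w - a (γ s))| < 2 := by
      rw [abs_sign_mul he, abs_lt]
      constructor <;> linarith [h1.1, h1.2, hw.1, hw.2]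
    rw [abs_lt] at h7
    constructor <;> linarith [h7.1, h7.2]
  have h8 := hS.unitSpeed_eqOn (s := a (γ s)) hc
    (fun w hw => (hγ _ (hmem w hw)).comp_affine he) (abs_lt.1 h1) h6
  exact ⟨_, hmem _ (abs_lt.1 h3), (h8 (abs_lt.1 h3)).symm.trans h4⟩

/-- On a compact regular curve, a long unit speed curve returns to its starting point. -/
lemma IsRegularCurve.exists_return {S : Set E3} (hS : IsRegularCurve S) (hc : IsCompact S)
    {q : E3} (hq : q ∈ S) : ∃ δ > 0, ∃ T, ∃ γ : ℝ → E3, γ 0 = q ∧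
      (∀ v ∈ Ioo (-δ) T, UnitSpeedAt S γ v) ∧ ∃ P ∈ Ioo 0 T, γ P = q := by
  obtain ⟨δ, hδ, hex⟩ := hS.exists_unitSpeed hc
  have hch : ∀ p, ∃ c a V r, p ∈ S → IsUnitChart S p c a V r := by
    intro p
    by_cases hp : p ∈ S
    · obtain ⟨c, a, V, r, h⟩ := hS.exists_isUnitChart hp
      exact ⟨c, a, V, r, fun _ => h⟩
    · exact ⟨fun _ => 0, fun _ => 0, ∅, 0, fun h => absurd h hp⟩
  choose c a V r hch using hch
  obtain ⟨I, hIS, hIc⟩ := hc.elim_nhds_subcover V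
    (fun p hp => (hch p hp).isOpen.mem_nhds (hch p hp).mem)
  set T : ℝ := 5 * (I.card + 2) with hT
  obtain ⟨γ, h0, hγ⟩ := hex q hq T
  refine ⟨δ, hδ, T, γ, h0, hγ, ?_⟩
  -- among the points at the times `5 k + 3`, two lie in the same chart of the finite cover
  have htime : ∀ k ∈ Finset.range (I.card + 1), ∀ v ∈ Ioo ((5 * k + 3 : ℝ) - 2) (5 * k + 3 + 2),
      v ∈ Ioo 0 T := by
    intro k hk v hv
    have h1 : (k : ℝ) ≤ I.card := by exact_mod_cast Nat.lt_succ_iff.1 (Finset.mem_range.1 hk)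
    have h2 : (0 : ℝ) ≤ k := k.cast_nonneg
    exact ⟨by linarith [hv.1], by linarith [hv.2]⟩
  have hUS : ∀ v ∈ Ioo 0 T, UnitSpeedAt S γ v := fun v hv => hγ v ⟨by linarith [hv.1], hv.2⟩
  have hmid : ∀ k : ℕ, (5 * k + 3 : ℝ) ∈ Ioo ((5 * k + 3 : ℝ) - 2) (5 * k + 3 + 2) := fun k =>
    ⟨by linarith, by linarith⟩
  have hcov : ∀ k ∈ Finset.range (I.card + 1), ∃ p ∈ I, γ (5 * k + 3) ∈ V p := by
    intro k hk
    have := hIc (hUS _ (htime k hk _ (hmid k))).1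
    simpa using this
  choose! f hfI hfV using hcov
  obtain ⟨k, hk, l, hl, hkl, hfkl⟩ := Finset.exists_ne_map_eq_of_card_lt_of_maps_to
    (by simp : I.card < (Finset.range (I.card + 1)).card) (f := f) (fun k hk => hfI k hk)
  have key : ∀ k ∈ Finset.range (I.card + 1), ∀ l ∈ Finset.range (I.card + 1), k < l →
      f k = f l → ∃ P ∈ Ioo 0 T, γ P = q := by
    intro k hk l hl hkl hfkl
    have hkl' : (k : ℝ) + 1 ≤ l := by exact_mod_cast hkl
    have hka := htime k hk _ (hmid k)
    obtain ⟨v, hv, hvk⟩ := (hch _ (hIS _ (hfI l hl))).exists_passage hS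
      (fun v hv => hUS v (htime l hl v hv)) (hfV l hl) (hUS _ hka).1 (hfkl ▸ hfV k hk)
    have hvT := htime l hl v hv
    have hlt : (5 * k + 3 : ℝ) < v := by linarith [hv.1]
    have h1 := hS.unitSpeed_translate hγ (v := -(5 * k + 3))
      ⟨by linarith [hka.1], hka.2⟩ ⟨by linarith [hvT.1], hvT.2⟩ hlt hvk.symm
      ⟨by linarith, by linarith [hka.1, hka.2]⟩ ⟨by linarith, by linarith [hvT.2, hka.1]⟩
    refine ⟨v + -(5 * k + 3), ⟨by linarith, by linarith [hvT.2, hka.1]⟩, ?_⟩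
    rw [← h1, add_neg_cancel, h0]
  rcases lt_or_gt_of_ne hkl with h | h
  · exact key k hk l hl h hfkl
  · exact key l hl k hk h hfkl.symm

/-- A connected component of a compact regular curve is a closed curve: it is parametrized by a
unit speed curve that is injective up to its first return to the starting point. -/
lemma IsRegularCurve.exists_closed_parametrization {S : Set E3} (hS : IsRegularCurve S)
    (hc : IsCompact S) {q : E3} (hq : q ∈ S) :
    ∃ L > 0, ∃ δ > 0, ∃ γ : ℝ → E3, (∀ v ∈ Ioo (-δ) (L + δ), UnitSpeedAt S γ v) ∧
      γ 0 = q ∧ γ L = q ∧ InjOn γ (Ico 0 L) ∧ connectedComponentIn S q = γ '' Icc 0 L := by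
  obtain ⟨δ, hδ, T, γ, h0, hγ, P, hP, hPq⟩ := hS.exists_return hc hq
  have h0I : (0 : ℝ) ∈ Ioo (-δ) T := ⟨by linarith, by linarith [hP.1, hP.2]⟩
  obtain ⟨η, hη, hinj⟩ := hS.unitSpeed_locally_injective (eventually_unitSpeedAt hγ h0I)
  have hleave : ∀ s, 0 < s → s < η → γ s ≠ q := by
    intro s hs hsη hsq
    have := hinj s 0 (by rwa [abs_of_pos hs]) (by simpa using hη) (by simp [hsq, h0])
    linarith
  -- the first return
  have hcont : ContinuousOn γ (Icc η P) := fun s hs =>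
    (hγ s ⟨by linarith [hs.1], by linarith [hs.2, hP.2]⟩).continuousAt.continuousWithinAt
  have hPη : η ≤ P := not_lt.1 fun h => hleave P hP.1 h hPq
  have hcpt : IsCompact (Icc η P ∩ γ ⁻¹' {q}) :=
    isCompact_Icc.of_isClosed_subset (hcont.preimage_isClosed_of_isClosed isClosed_Icc
      isClosed_singleton) inter_subset_left
  obtain ⟨L, ⟨⟨hηL, hLP⟩, hLq⟩, hmin⟩ := hcpt.exists_isLeast ⟨P, ⟨hPη, le_rfl⟩, hPq⟩
  have hLq : γ L = q := hLq
  have hL : 0 < L := by linarith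
  have hfirst : ∀ s, 0 < s → s < L → γ s ≠ q := by
    intro s hs hsL hsq
    have hηs : η ≤ s := not_lt.1 fun h => hleave s hs h hsq
    exact absurd (hmin ⟨⟨hηs, by linarith⟩, hsq⟩) (not_le.2 hsL)
  have hLT : L < T := by linarith [hP.2]
  have hLI : L ∈ Ioo (-δ) T := ⟨by linarith, hLT⟩
  have hinjL : ∀ a b, 0 ≤ a → a < b → b < L → γ a ≠ γ b := by
    intro a b ha hab hb h
    have := hS.unitSpeed_translate hγ (v := -a) ⟨by linarith, by linarith⟩
      ⟨by linarith, by linarith⟩ hab h ⟨by linarith, by linarith⟩ ⟨by linarith, by linarith⟩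
    rw [add_neg_cancel, h0] at this
    exact hfirst (b + -a) (by linarith) (by linarith) this.symm
  refine ⟨L, hL, min δ (T - L), lt_min hδ (by linarith), γ, fun v hv => hγ v
    ⟨by linarith [hv.1, min_le_left δ (T - L)], by linarith [hv.2, min_le_right δ (T - L)]⟩,
    h0, hLq, ?_, ?_⟩
  · intro a ha b hb hab
    rcases lt_trichotomy a b with h | h | h
    · exact absurd hab (hinjL a b ha.1 h hb.2)
    · exact h
    · exact absurd hab.symm (hinjL b a hb.1 h ha.2)
  -- the image is connected, and open and closed in `S`
  have hcontL : ContinuousOn γ (Icc 0 L) := fun s hs =>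
    (hγ s ⟨by linarith [hs.1], by linarith [hs.2]⟩).continuousAt.continuousWithinAt
  have hIS : γ '' Icc 0 L ⊆ S := by
    rintro _ ⟨s, hs, rfl⟩
    exact (hγ s ⟨by linarith [hs.1], by linarith [hs.2]⟩).1
  have hqI : q ∈ γ '' Icc 0 L := ⟨0, ⟨le_rfl, hL.le⟩, h0⟩
  have hq_nhds : ∀ᶠ x in 𝓝 q, x ∈ S → x ∈ γ '' Icc 0 L := by
    have hε : 0 < min δ L := lt_min hδ hL
    have h1 := hS.unitSpeed_open (eventually_unitSpeedAt hγ h0I) hε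
    rw [h0] at h1
    filter_upwards [h1] with x hx hxS
    obtain ⟨v, hv, rfl⟩ := hx hxS
    have hv1 : -δ < v := by linarith [hv.1, min_le_left δ L]
    have hv2 : -L < v := by linarith [hv.1, min_le_right δ L]
    have hv3 : v < L := by linarith [hv.2, min_le_right δ L]
    rcases le_or_gt 0 v with h | h
    · exact ⟨v, ⟨h, hv3.le⟩, rfl⟩
    · refine ⟨L + v, ⟨by linarith, by linarith⟩, ?_⟩
      have := hS.unitSpeed_translate hγ (v := v) h0I hLI hL (h0.trans hLq.symm)
        ⟨by linarith, by linarith⟩ ⟨by linarith, by linarith⟩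
      rw [zero_add] at this
      exact this.symm
  have hopen : ∀ y ∈ γ '' Icc 0 L, ∀ᶠ x in 𝓝 y, x ∈ S → x ∈ γ '' Icc 0 L := by
    rintro _ ⟨s, hs, rfl⟩
    rcases hs.1.eq_or_lt with h | h
    · rw [← h, h0]; exact hq_nhds
    rcases hs.2.eq_or_lt with h' | h'
    · rw [h', hLq]; exact hq_nhds
    have h1 := hS.unitSpeed_open (eventually_unitSpeedAt hγ (s := s)
      ⟨by linarith, by linarith⟩) (η := min s (L - s)) (lt_min h (by linarith))
    filter_upwards [h1] with x hx hxS
    refine image_mono (fun v hv => ?_) (hx hxS)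
    exact ⟨by linarith [hv.1, min_le_left s (L - s)], by linarith [hv.2, min_le_right s (L - s)]⟩
  apply Subset.antisymm
  · have hpre := isPreconnected_iff_subset_of_disjoint.1
      (isPreconnected_connectedComponentIn (x := q) (F := S))
      {x | ∀ᶠ y in 𝓝 x, y ∈ S → y ∈ γ '' Icc 0 L} (γ '' Icc 0 L)ᶜ
      isOpen_setOfPred_eventually_nhds
      (isCompact_Icc.image_of_continuousOn hcontL).isClosed.isOpen_compl
      (fun x _ => or_iff_not_imp_right.2 fun h => hopen x (not_not.1 h))
      (by
        rw [eq_empty_iff_forall_notMem]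
        rintro x ⟨h1, h2, h3⟩
        exact h3 (h2.self_of_nhds (connectedComponentIn_subset _ _ h1)))
    rcases hpre with h | h
    · exact fun x hx => (h hx).self_of_nhds (connectedComponentIn_subset _ _ hx)
    · exact absurd hqI (h (mem_connectedComponentIn hq))
  · exact (isPreconnected_Icc.image γ hcontL).subset_connectedComponentIn hqI hIS

/-- Connected components of a regular curve are relatively open. -/
lemma IsRegularCurve.eventually_mem_connectedComponentIn {S : Set E3} (hS : IsRegularCurve S)
    {q p : E3} (hp : p ∈ connectedComponentIn S q) :
    ∀ᶠ x in 𝓝 p, x ∈ S → x ∈ connectedComponentIn S q := by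
  have hpS := connectedComponentIn_subset _ _ hp
  obtain ⟨c, a, V, r, hch⟩ := hS.exists_isUnitChart hpS
  have hcS : c '' Ioo (-r) r ⊆ S := by
    rintro _ ⟨v, hv, rfl⟩
    exact (hch.unitSpeed v (abs_lt.2 hv)).1
  have hpc : p ∈ c '' Ioo (-r) r := ⟨0, ⟨by linarith [hch.pos], hch.pos⟩, hch.map_zero⟩
  have hcc : ContinuousOn c (Ioo (-r) r) := fun v hv =>
    (hch.unitSpeed v (abs_lt.2 hv)).continuousAt.continuousWithinAt
  have hsub := (isPreconnected_Ioo.image c hcc).subset_connectedComponentIn hpc hcS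
  rw [← connectedComponentIn_eq hp] at hsub
  filter_upwards [hch.isOpen.mem_nhds hch.mem] with x hx hxS
  obtain ⟨h1, h2⟩ := hch.right_inv x hx hxS
  exact hsub ⟨a x, abs_lt.1 h1, h2⟩

/-- On a component of a compact regular curve, cut at `q`, the restriction of `F` has a primitive:
a function `h` from which any local potential of `-F` differs by a local constant. -/
lemma IsRegularCurve.exists_primitive {S : Set E3} (hS : IsRegularCurve S) (hc : IsCompact S)
    {q : E3} (hq : q ∈ S) : ∃ h : E3 → ℝ, ∀ p ∈ connectedComponentIn S q, p ≠ q →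
      ∀ φ : E3 → ℝ, ContDiff ℝ ∞ φ → (∀ᶠ x in 𝓝 p, x ∈ S → F x + gradient φ x = 0) →
        ∃ k : ℝ, ∀ᶠ x in 𝓝 p, x ∈ S → φ x = h x + k := by
  obtain ⟨L, hL, δ, hδ, γ, hγ, h0, hLq, hinj, himg⟩ := hS.exists_closed_parametrization hc hq
  set f : ℝ → ℝ := fun s => -inner ℝ (F (γ s)) (deriv γ s) with hf
  have hγ' : ∀ v ∈ Ioo 0 L, UnitSpeedAt S γ v := fun v hv =>
    hγ v ⟨by linarith [hv.1], by linarith [hv.2]⟩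
  have hfc : ContinuousOn f (Ioo 0 L) := fun s hs => by
    have h1 : ContinuousAt (deriv γ) s := by
      have := ((hγ' s hs).2.1.fderiv_right (m := 0) (by simp)).continuousAt
      exact this.clm_apply (continuousAt_const (y := (1 : ℝ)))
    exact ((contDiff_F.continuous.continuousAt.comp (hγ' s hs).continuousAt).inner
      h1).neg.continuousWithinAt
  have hH : ∀ s ∈ Ioo 0 L, HasDerivAt (fun s => ∫ τ in (L / 2)..s, f τ) (f s) s := fun s hs => by
    refine intervalIntegral.integral_hasDerivAt_right ?_
      (hfc.stronglyMeasurableAtFilter isOpen_Ioo s hs) (hfc.continuousAt (isOpen_Ioo.mem_nhds hs))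
    refine (hfc.mono ?_).intervalIntegrable
    exact ordConnected_Ioo.uIcc_subset ⟨by linarith, by linarith⟩ hs
  have hleft := (hinj.mono (Ioo_subset_Ico_self)).leftInvOn_invFunOn
  refine ⟨fun x => ∫ τ in (L / 2)..(Function.invFunOn γ (Ioo 0 L) x), f τ, ?_⟩
  intro p hp hpq φ hφ hFφ
  rw [himg] at hp
  obtain ⟨s, hs, rfl⟩ := hp
  have hs' : s ∈ Ioo 0 L := by
    refine ⟨lt_of_le_of_ne hs.1 ?_, lt_of_le_of_ne hs.2 ?_⟩
    · rintro rfl; exact hpq h0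
    · rintro rfl; exact hpq hLq
  obtain ⟨η, hη, hsub⟩ := exists_Ioo_of_eventually
    ((isOpen_Ioo.eventually_mem hs').and ((hγ' s hs').continuousAt.eventually hFφ))
  -- along the curve, the difference of `φ` and the primitive has derivative zero
  have hd : ∀ v ∈ Ioo (s - η) (s + η),
      HasDerivAt (fun v => φ (γ v) - ∫ τ in (L / 2)..v, f τ) 0 v := by
    intro v hv
    obtain ⟨hv1, hv2⟩ := hsub v hv
    have h1 := (hφ.differentiable (by simp) (γ v)).hasGradientAt.hasFDerivAt.comp_hasDerivAt v
      (hγ' v hv1).hasDerivAt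
    refine (h1.sub (hH v hv1)).congr_deriv ?_
    have h2 := hv2 (hγ' v hv1).1
    rw [add_eq_zero_iff_eq_neg'] at h2
    simp [hf, h2]
  obtain ⟨k, hk⟩ := isOpen_Ioo.exists_is_const_of_deriv_eq_zero isPreconnected_Ioo
    (fun v hv => (hd v hv).differentiableAt.differentiableWithinAt) (fun v hv => (hd v hv).deriv)
  refine ⟨k, ?_⟩
  filter_upwards [hS.unitSpeed_open (eventually_unitSpeedAt hγ' hs') hη] with x hx hxS
  obtain ⟨v, hv, rfl⟩ := hx hxS
  rw [hleft (hsub v hv).1]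
  linarith [hk v hv]

/-! ### Gluing local potentials -/

/-- Near `p`, the gauge transformation by `φ` has the required precision, and `φ` restricts to `h`
on `Γ`. -/
def IsPotentialAt (Ω : Set E3) (h φ : E3 → ℝ) (p : E3) : Prop :=
  (∃ C, ∀ᶠ x in 𝓝 p, ‖F x + gradient φ x‖ ≤ C * (t Ω x + Metric.infDist x (Gam Ω) ^ 2)) ∧
    ∀ᶠ x in 𝓝 p, x ∈ Gam Ω → φ x = h x

lemma isOpen_isPotentialAt (Ω : Set E3) (h φ : E3 → ℝ) : IsOpen {p | IsPotentialAt Ω h φ p} := by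
  rw [isOpen_iff_mem_nhds]
  rintro p ⟨⟨C, h1⟩, h2⟩
  filter_upwards [h1.eventually_nhds, h2.eventually_nhds] with y h3 h4 using ⟨⟨C, h3⟩, h4⟩

lemma IsPotentialAt.congr {Ω : Set E3} {h φ φ' : E3 → ℝ} {p : E3} (hφ : IsPotentialAt Ω h φ p)
    (he : φ' =ᶠ[𝓝 p] φ) : IsPotentialAt Ω h φ' p := by
  obtain ⟨⟨C, h1⟩, h2⟩ := hφ
  refine ⟨⟨C, ?_⟩, ?_⟩
  · filter_upwards [h1, he.gradient] with x h3 h4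
    rwa [h4]
  · filter_upwards [h2, he] with x h3 h4
    rwa [h4]

lemma eventually_eq_zero_of_bound {Ω : Set E3} {A : E3 → E3} {p : E3} {C : ℝ}
    (h : ∀ᶠ x in 𝓝 p, ‖A x‖ ≤ C * (t Ω x + Metric.infDist x (Gam Ω) ^ 2)) :
    ∀ᶠ x in 𝓝 p, x ∈ Gam Ω → A x = 0 := by
  filter_upwards [h] with x hx hxΓ
  have h1 : t Ω x = 0 := Metric.infDist_zero_of_mem hxΓ.1
  rw [h1, Metric.infDist_zero_of_mem hxΓ] at hx
  simpa using hx

lemma gradient_add {f g : E3 → ℝ} {x : E3} (hf : DifferentiableAt ℝ f x)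
    (hg : DifferentiableAt ℝ g x) :
    gradient (fun x => f x + g x) x = gradient f x + gradient g x := by
  simp only [gradient]
  rw [fderiv_fun_add hf hg, map_add]

lemma gradient_mul {f g : E3 → ℝ} {x : E3} (hf : DifferentiableAt ℝ f x)
    (hg : DifferentiableAt ℝ g x) :
    gradient (fun x => f x * g x) x = f x • gradient g x + g x • gradient f x := by
  simp only [gradient]
  rw [fderiv_fun_mul hf hg, map_add]
  simp

lemma gradient_sub {f g : E3 → ℝ} {x : E3} (hf : DifferentiableAt ℝ f x)
    (hg : DifferentiableAt ℝ g x) :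
    gradient (fun x => f x - g x) x = gradient f x - gradient g x := by
  simp only [gradient]
  rw [fderiv_fun_sub hf hg, map_sub]

/-- Two potentials with the same restriction to `Γ` agree to second order along `Γ`, so that the
derivative of a cut-off function between them does no harm. -/
lemma IsPotentialAt.glue {Ω : Set E3} (hΓ : IsCompact (Gam Ω)) {h φ₁ φ₂ χ : E3 → ℝ} {p : E3}
    (hp : p ∈ Gam Ω) (h₁ : IsPotentialAt Ω h φ₁ p) (h₂ : IsPotentialAt Ω h φ₂ p)
    (hφ₁ : ContDiff ℝ ∞ φ₁) (hφ₂ : ContDiff ℝ ∞ φ₂) (hχ : ContDiff ℝ ∞ χ)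
    (hχ1 : ∀ x, χ x ∈ Icc (0 : ℝ) 1) :
    IsPotentialAt Ω h (fun x => φ₂ x + χ x * (φ₁ x - φ₂ x)) p := by
  obtain ⟨⟨C₁, hC₁⟩, he₁⟩ := h₁
  obtain ⟨⟨C₂, hC₂⟩, he₂⟩ := h₂
  have hd₁ := hφ₁.differentiable (by simp)
  have hd₂ := hφ₂.differentiable (by simp)
  have hdχ := hχ.differentiable (by simp)
  have hψ := hφ₁.sub hφ₂
  obtain ⟨C, hC, r, hr, hT⟩ := exists_taylor_bound hψ.contDiffAt (p := p)
  have hψ0 : ∀ᶠ z in 𝓝 p, z ∈ Gam Ω → φ₁ z - φ₂ z = 0 ∧ fderiv ℝ (fun x => φ₁ x - φ₂ x) z = 0 := by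
    filter_upwards [he₁, he₂, eventually_eq_zero_of_bound hC₁, eventually_eq_zero_of_bound hC₂]
      with z k1 k2 k3 k4 hz
    refine ⟨by rw [k1 hz, k2 hz, sub_self], ?_⟩
    have h5 : gradient (fun x => φ₁ x - φ₂ x) z = 0 := by
      rw [gradient_sub (hd₁ z) (hd₂ z), ← add_sub_add_left_eq_sub _ _ (F z), k3 hz, k4 hz, sub_self]
    rw [← toDual_gradient, h5, map_zero]
  have hψb : ∀ᶠ x in 𝓝 p, |φ₁ x - φ₂ x| ≤ C * Metric.infDist x (Gam Ω) ^ 2 := by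
    filter_upwards [eventually_of_closest hp (hψ0.and (Metric.ball_mem_nhds p hr)),
      Metric.ball_mem_nhds p hr] with x hx hxr
    obtain ⟨z, hz, hxz⟩ := hΓ.exists_infDist_eq_dist ⟨p, hp⟩ x
    obtain ⟨k1, k2⟩ := hx z hxz.symm
    obtain ⟨k3, k4⟩ := k1 hz
    have := hT x hxr z k2
    simpa [k3, k4, ← dist_eq_norm, ← hxz] using this
  refine ⟨⟨C₂ + (C₁ + C₂) + C * (‖gradient χ p‖ + 1), ?_⟩, ?_⟩
  · have hgc : ContinuousAt (fun x => ‖gradient χ x‖) p := by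
      have : Continuous (gradient χ) :=
        (InnerProductSpace.toDual ℝ E3).symm.continuous.comp (hχ.continuous_fderiv (by simp))
      exact this.norm.continuousAt
    filter_upwards [hC₁, hC₂, hψb, hgc.eventually (ge_mem_nhds (lt_add_one _))]
      with x k1 k2 k3 k4
    have hg : F x + gradient (fun x => φ₂ x + χ x * (φ₁ x - φ₂ x)) x = (F x + gradient φ₂ x) +
        χ x • ((F x + gradient φ₁ x) - (F x + gradient φ₂ x)) +
        (φ₁ x - φ₂ x) • gradient χ x := by
      have hdψ : DifferentiableAt ℝ (fun x => φ₁ x - φ₂ x) x := (hd₁ x).sub (hd₂ x)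
      have hdχψ : DifferentiableAt ℝ (fun x => χ x * (φ₁ x - φ₂ x)) x := (hdχ x).mul hdψ
      rw [gradient_add (hd₂ x) hdχψ, gradient_mul (hdχ x) hdψ, gradient_sub (hd₁ x) (hd₂ x)]
      module
    have ht0 : 0 ≤ t Ω x := Metric.infDist_nonneg
    set D := t Ω x + Metric.infDist x (Gam Ω) ^ 2 with hD
    have hle : Metric.infDist x (Gam Ω) ^ 2 ≤ D := by linarith
    have h1 : ‖χ x • ((F x + gradient φ₁ x) - (F x + gradient φ₂ x))‖ ≤ C₁ * D + C₂ * D := by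
      rw [norm_smul, Real.norm_of_nonneg (hχ1 x).1]
      exact (mul_le_of_le_one_left (norm_nonneg _) (hχ1 x).2).trans
        ((norm_sub_le _ _).trans (add_le_add k1 k2))
    have h2 : ‖(φ₁ x - φ₂ x) • gradient χ x‖ ≤ C * D * (‖gradient χ p‖ + 1) := by
      rw [norm_smul, Real.norm_eq_abs]
      exact mul_le_mul (k3.trans (mul_le_mul_of_nonneg_left hle hC)) k4 (norm_nonneg _)
        (mul_nonneg hC (by positivity))
    rw [hg]
    refine (norm_add_le _ _).trans ((add_le_add ((norm_add_le _ _).trans (add_le_add k2 h1))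
      h2).trans (le_of_eq ?_))
    ring
  · filter_upwards [he₁, he₂] with x k1 k2 hx
    rw [k1 hx, k2 hx]
    ring

lemma exists_potential_of_local {Ω : Set E3} (hΓ : IsCompact (Gam Ω)) {h : E3 → ℝ} {K : Set E3}
    (hK : IsCompact K) (hKΓ : K ⊆ Gam Ω)
    (hloc : ∀ p ∈ K, ∃ φ : E3 → ℝ, ContDiff ℝ ∞ φ ∧ IsPotentialAt Ω h φ p) :
    ∃ φ : E3 → ℝ, ContDiff ℝ ∞ φ ∧ ∀ p ∈ K, IsPotentialAt Ω h φ p := by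
  have key : ∃ φ : E3 → ℝ, ContDiff ℝ ∞ φ ∧ ∀ p ∈ closure K ∩ K, IsPotentialAt Ω h φ p := by
    refine hK.induction_on (p := fun K' => ∃ φ : E3 → ℝ, ContDiff ℝ ∞ φ ∧
      ∀ p ∈ closure K' ∩ K, IsPotentialAt Ω h φ p) ⟨fun _ => 0, contDiff_const, by simp⟩ ?_ ?_ ?_
    · rintro K₁ K₂ hsub ⟨φ, hφ, hp⟩
      exact ⟨φ, hφ, fun p hp' => hp p ⟨closure_mono hsub hp'.1, hp'.2⟩⟩
    · rintro K₁ K₂ ⟨φ₁, hφ₁, hp₁⟩ ⟨φ₂, hφ₂, hp₂⟩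
      set U := {p | IsPotentialAt Ω h φ₁ p} with hU
      have hUo : IsOpen U := isOpen_isPotentialAt Ω h φ₁
      obtain ⟨χ, hχ0, hχ1, hχ⟩ := exists_contMDiffMap_zero_one_nhds_of_isClosed
        (n := ⊤) (modelWithCornersSelf ℝ E3) hUo.isClosed_compl
        (isClosed_closure.inter hK.isClosed : IsClosed (closure K₁ ∩ K))
        (disjoint_compl_left_iff_subset.2 hp₁)
      have hχc : ContDiff ℝ ∞ χ := χ.contMDiff.contDiff
      refine ⟨fun x => φ₂ x + χ x * (φ₁ x - φ₂ x), hφ₂.add (hχc.mul (hφ₁.sub hφ₂)), ?_⟩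
      rintro p ⟨hp, hpK⟩
      rw [closure_union] at hp
      rcases hp with hp | hp
      · refine (hp₁ p ⟨hp, hpK⟩).congr ?_
        filter_upwards [eventually_nhdsSet_iff_forall.1 hχ1 p ⟨hp, hpK⟩] with x hx
        rw [hx]; ring
      · by_cases hpU : p ∈ U
        · exact IsPotentialAt.glue hΓ (hKΓ hpK) hpU (hp₂ p ⟨hp, hpK⟩) hφ₁ hφ₂ hχc hχ
        · refine (hp₂ p ⟨hp, hpK⟩).congr ?_
          filter_upwards [eventually_nhdsSet_iff_forall.1 hχ0 p hpU] with x hx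
          rw [hx]; ring
    · intro p hp
      obtain ⟨φ, hφ, hφp⟩ := hloc p hp
      obtain ⟨r, hr, hsub⟩ := Metric.nhds_basis_closedBall.mem_iff.1
        ((isOpen_isPotentialAt Ω h φ).mem_nhds hφp)
      refine ⟨_, nhdsWithin_le_nhds (Metric.closedBall_mem_nhds p hr), φ, hφ, ?_⟩
      rintro y ⟨hy, -⟩
      rw [Metric.isClosed_closedBall.closure_eq] at hy
      exact hsub hy
  obtain ⟨φ, hφ, h1⟩ := key
  exact ⟨φ, hφ, fun p hp => h1 p ⟨subset_closure hp, hp⟩⟩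

/-! ### The estimate on the cut tube -/

lemma exists_bound_of_local {D : Set E3} (hD : IsCompact D) {f g : E3 → ℝ} (hg : ∀ x, 0 ≤ g x)
    (h : ∀ q ∈ D, ∃ C, ∀ᶠ x in 𝓝 q, f x ≤ C * g x) : ∃ C, 0 ≤ C ∧ ∀ x ∈ D, f x ≤ C * g x := by
  refine hD.induction_on (p := fun D => ∃ C, 0 ≤ C ∧ ∀ x ∈ D, f x ≤ C * g x)
    ⟨0, le_rfl, by simp⟩ ?_ ?_ ?_
  · rintro D D' hsub ⟨C, hC, h⟩
    exact ⟨C, hC, fun x hx => h x (hsub hx)⟩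
  · rintro D D' ⟨C, hC, h⟩ ⟨C', hC', h'⟩
    refine ⟨C + C', add_nonneg hC hC', fun x hx => ?_⟩
    rw [add_mul]
    rcases hx with hx | hx
    · linarith [h x hx, mul_nonneg hC' (hg x)]
    · linarith [h' x hx, mul_nonneg hC (hg x)]
  · intro q hq
    obtain ⟨C, hC⟩ := h q hq
    exact ⟨_, nhdsWithin_le_nhds hC, |C|, abs_nonneg C, fun x hx =>
      (hx : f x ≤ C * g x).trans (mul_le_mul_of_nonneg_right (le_abs_self C) (hg x))⟩

/-- A component of `Γ` has a neighbourhood that does not meet the other components. -/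
lemma exists_separation {S : Set E3} (hS : IsRegularCurve S) (hc : IsCompact S) {q : E3}
    (hcq : IsCompact (connectedComponentIn S q)) :
    ∃ ε₀ > 0, ∀ x ∈ S, Metric.infDist x (connectedComponentIn S q) ≤ ε₀ →
      (connectedComponentIn S q).Nonempty → x ∈ connectedComponentIn S q := by
  have hcl : IsClosed (S \ connectedComponentIn S q) := by
    have h1 : S \ connectedComponentIn S q =
        S ∩ {x | ∀ᶠ y in 𝓝 x, y ∈ S → y ∈ connectedComponentIn S q}ᶜ := by
      ext x
      refine ⟨fun ⟨h1, h2⟩ => ⟨h1, fun h3 => h2 (h3.self_of_nhds h1)⟩,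
        fun ⟨h1, h2⟩ => ⟨h1, fun h3 => h2 (hS.eventually_mem_connectedComponentIn h3)⟩⟩
    rw [h1]
    exact hc.isClosed.inter isOpen_setOfPred_eventually_nhds.isClosed_compl
  obtain ⟨δ, hδ, hdis⟩ := disjoint_sdiff_right.exists_cthickenings hcq hcl
  refine ⟨δ, hδ, fun x hx hxd hne => ?_⟩
  by_contra hxn
  obtain ⟨z, hz, hxz⟩ := hcq.exists_infDist_eq_dist hne x
  exact disjoint_left.1 hdis (Metric.mem_cthickening_of_dist_le x z δ _ hz (hxz ▸ hxd))
    (Metric.self_subset_cthickening _ ⟨hx, hxn⟩)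

end GaugeNearTangency

open GaugeNearTangency in
theorem proposition3p8
    (Ω : Set E3) (hΩ_open : IsOpen Ω) (hΩ_bdd : Bornology.IsBounded Ω)
    (hΩ_sc : SimplyConnectedSpace Ω) (hΩ_bdry_conn : IsConnected (frontier Ω))
    (hΩ_smooth : HasSmoothBoundary Ω)
    (hΓ : IsRegularCurve (Gam Ω))
    (Γj : Set E3) (hΓj : ∃ p ∈ Gam Ω, Γj = connectedComponentIn (Gam Ω) p)
    (s₀ : E3) (hs₀ : s₀ ∈ Γj) :
    ∃ ε₀ : ℝ, 0 < ε₀ ∧ ∀ ε : ℝ, 0 < ε → ε < ε₀ →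
      ∃ φ : E3 → ℝ, ContDiff ℝ ∞ φ ∧
        ∃ C : ℝ, ∀ x ∈ cutTube Ω Γj ε s₀,
          ‖F x + gradient φ x‖ ≤ C * (t Ω x + dGam Ω x ^ 2) := by
  have hΓc := isCompact_Gam hΩ_open hΩ_bdd hΩ_smooth
  obtain ⟨p₀, -, rfl⟩ := hΓj
  have hs₀Γ : s₀ ∈ Gam Ω := connectedComponentIn_subset _ _ hs₀
  rw [connectedComponentIn_eq hs₀] at *
  have hne : (connectedComponentIn (Gam Ω) s₀).Nonempty := ⟨s₀, hs₀⟩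
  have hjc : IsCompact (connectedComponentIn (Gam Ω) s₀) := by
    obtain ⟨L, hL, δ, hδ, γ, hγ, -, -, -, himg⟩ := hΓ.exists_closed_parametrization hΓc hs₀Γ
    rw [himg]
    exact isCompact_Icc.image_of_continuousOn fun v hv =>
      (hγ v ⟨by linarith [hv.1], by linarith [hv.2]⟩).continuousAt.continuousWithinAt
  obtain ⟨ε₀, hε₀, hsep⟩ := exists_separation hΓ hΓc hjc
  obtain ⟨h, hh⟩ := hΓ.exists_primitive hΓc hs₀Γ
  refine ⟨ε₀, hε₀, fun ε hε hεε₀ => ?_⟩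
  -- a potential near the part of the component outside the ball about `s₀`
  set K := connectedComponentIn (Gam Ω) s₀ ∩ {x | ε ≤ dist x s₀} with hK
  have hKc : IsCompact K :=
    hjc.inter_right (isClosed_le continuous_const (continuous_id.dist continuous_const))
  have hKΓ : K ⊆ Gam Ω := fun x hx => connectedComponentIn_subset _ _ hx.1
  obtain ⟨φ, hφ, hφK⟩ := exists_potential_of_local (h := h) hΓc hKc hKΓ (by
    intro p hp
    obtain ⟨φ, hφ, C, hC⟩ := exists_local_potential hΩ_open hΩ_bdd hΩ_smooth hΓ (hKΓ hp)
    have hps : p ≠ s₀ := by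
      rintro rfl
      have := hp.2
      simp only [Set.mem_ofPred_eq, dist_self] at this
      linarith
    obtain ⟨k, hk⟩ := hh p hp.1 hps φ hφ (eventually_eq_zero_of_bound hC)
    refine ⟨fun x => φ x - k, hφ.sub contDiff_const, ⟨C, ?_⟩, ?_⟩
    · filter_upwards [hC] with x hx
      rwa [gradient_sub (hφ.differentiable (by simp) x) (differentiableAt_const k),
        gradient_fun_const, sub_zero]
    · filter_upwards [hk] with x hx hxΓ
      rw [hx hxΓ, add_sub_cancel_right])
  refine ⟨φ, hφ, ?_⟩
  have hδ0 : ∀ x, 0 ≤ t Ω x + Metric.infDist x (Gam Ω) ^ 2 := fun x =>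
    add_nonneg Metric.infDist_nonneg (sq_nonneg _)
  have hDc : IsCompact (closure (cutTube Ω (connectedComponentIn (Gam Ω) s₀) ε s₀)) :=
    (hΩ_bdd.subset fun x hx => hx.1).isCompact_closure
  have hDsub : closure (cutTube Ω (connectedComponentIn (Gam Ω) s₀) ε s₀) ⊆
      {x | Metric.infDist x (connectedComponentIn (Gam Ω) s₀) ≤ ε ∧ ε ≤ dist x s₀} := by
    refine closure_minimal (fun x hx => ⟨hx.2.1.le, hx.2.2.le⟩) ?_
    exact (isClosed_le (Metric.continuous_infDist_pt _) continuous_const).inter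
      (isClosed_le continuous_const (continuous_id.dist continuous_const))
  obtain ⟨C, hC0, hC⟩ := exists_bound_of_local hDc hδ0 (f := fun x => ‖F x + gradient φ x‖) (by
    intro q hq
    by_cases hqΓ : q ∈ Gam Ω
    · exact (hφK q ⟨hsep q hqΓ ((hDsub hq).1.trans hεε₀.le) hne, (hDsub hq).2⟩).1
    -- away from `Γ`, the right hand side is bounded below
    · have hpos : 0 < Metric.infDist q (Gam Ω) :=
        (hΓc.isClosed.notMem_iff_infDist_pos ⟨s₀, hs₀Γ⟩).1 hqΓ
      set m := Metric.infDist q (Gam Ω) / 2 with hm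
      have hm0 : 0 < m := half_pos hpos
      have hcont : Continuous fun x => ‖F x + gradient φ x‖ :=
        (contDiff_F.continuous.add ((InnerProductSpace.toDual ℝ E3).symm.continuous.comp
          (hφ.continuous_fderiv (by simp)))).norm
      set M := ‖F q + gradient φ q‖ + 1 with hM
      have hM0 : 0 ≤ M := by positivity
      refine ⟨M / m ^ 2, ?_⟩
      filter_upwards [hcont.continuousAt.eventually (ge_mem_nhds (lt_add_one _)),
        (Metric.continuous_infDist_pt (Gam Ω)).continuousAt.eventually
          (lt_mem_nhds (half_lt_self hpos))] with x h1 h2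
      have h3 : m ^ 2 ≤ t Ω x + Metric.infDist x (Gam Ω) ^ 2 := by
        have h4 : 0 ≤ t Ω x := Metric.infDist_nonneg
        have h5 : m ^ 2 ≤ Metric.infDist x (Gam Ω) ^ 2 := pow_le_pow_left₀ hm0.le h2.le 2
        linarith
      calc _ ≤ M := h1
        _ = M / m ^ 2 * m ^ 2 := by field_simp
        _ ≤ _ := mul_le_mul_of_nonneg_left h3 (by positivity))
  refine ⟨C * (1 + 2 * ε + 2), fun x hx => ?_⟩
  have h1 := hC x (subset_closure hx)
  have h2 := infDist_Gam_le hΩ_open hΩ_bdd hΩ_smooth hΩ_bdry_conn.isPreconnected ⟨s₀, hs₀Γ⟩ x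
  have ht0 : 0 ≤ t Ω x := Metric.infDist_nonneg
  have htε : t Ω x ≤ ε :=
    (Metric.infDist_le_infDist_of_subset
      (fun y hy => (connectedComponentIn_subset (Gam Ω) s₀ hy).1) hne).trans hx.2.1.le
  have h3 := pow_le_pow_left₀ Metric.infDist_nonneg h2 2
  have h4 : t Ω x ^ 2 ≤ ε * t Ω x := by
    rw [pow_two]; exact mul_le_mul_of_nonneg_right htε ht0
  have h5 : t Ω x + Metric.infDist x (Gam Ω) ^ 2 ≤
      (1 + 2 * ε + 2) * (t Ω x + dGam Ω x ^ 2) := by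
    nlinarith [sq_nonneg (dGam Ω x - t Ω x), sq_nonneg (dGam Ω x),
      mul_nonneg hε.le (sq_nonneg (dGam Ω x))]
  calc _ ≤ _ := h1
    _ ≤ _ := mul_le_mul_of_nonneg_left h5 hC0
    _ = _ := by ring
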